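/- Let $F$ be a totally real number field with set of infinite places $\Sigma_F$, let $E\subseteq F$ be a subfield, and let $\underline k=(k_\sigma)_{\sigma\in\Sigma_F}$ be a family of integers. Put $G=\mathrm{Res}_{F/E}\mathrm{GL}_2$ and $G^*=G\times_{\mathrm{Res}_{F/E}\mathrm{GL}_1}\mathrm{GL}_1$, so that $G^*(E)=\{g\in\mathrm{GL}_2(F):\det g\in E^\times\}$. Let $T$ be the diagonal torus of $G$ and $T^*=T\cap G^*$. For an infinite (necessarily real) place $\tau$ of $E$ we have $G\times_{E,\tau}\mathbf C=\prod_{\sigma\mid\tau}\mathrm{GL}_2$; let $X_\bullet(\hat T)=X^\bullet(T)$ and $X_\bullet(\hat T^*)=X^\bullet(T^*)$ be the cocharacter lattices of the dual tori, and write $\lambda\mapsto\lambda^*$ for the map $X_\bullet(\hat T)\otimes\mathbf C\to X_\bullet(\hat T^*)\otimes\mathbf C$ induced by restriction of characters to $T^*$. For $\underline t\in\mathbf R^{\Sigma_F}$ let $\mathrm{GL}_2^+(F\otimes\mathbf R)$ act on functions on $\mathfrak H_F=\mathfrak H^{\Sigma_F}$ by $$(h\mid_{\underline k,\underline t}\gamma)(z)=\prod_\sigma\det(\gamma_\sigma)^{k_\sigma+t_\sigma-1}(c_\sigma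 z_\sigma+d_\sigma)^{-k_\sigma}\,h(\gamma z),$$ and let $M_{\underline k,\underline t}$ be the space of Hilbert modular forms of weight $(\underline k,\underline t)$: functions $f:\mathrm{GL}_2(\mathbf A_{F,\mathrm f})\times\mathfrak H_F\to\mathbf C$, holomorphic in the second variable, right invariant under an open compact subgroup of $\mathrm{GL}_2(\mathbf A_{F,\mathrm f})$, with $f(\gamma g,-)=f(g,-)\mid_{\underline k,\underline t}\gamma^{-1}$ for all $\gamma\in\mathrm{GL}_2^+(F)$ (and holomorphic at the cusps if $F=\mathbf Q$). The Harish-Chandra parameter $\lambda_\tau\in X_\bullet(\hat T)\otimes\mathbf C$ (a Weyl group orbit) of a nonzero $\mathrm{GL}_2(\mathbf A_{F,\mathrm f})$-subrepresentation $\Pi\subseteq M_{\underline k,\underline t}$ at $\tau$ is the parameter, under the Harish-Chandra homomorphism, of the character through which the centre of $U(\mathfrak g_\tau)$, $\mathfrak g_\tau=\prod_{\sigma\mid\tau}\mathfrak{gl}_2(\mathbf C)$, acts by right translation on the functions $g_\infty\mapsto(f(g,-)\mid_{\underline k,\underline t}g_\infty)(i,\dots,i)$ with $f\in\Pi$, $g\in\mathrm{GL}_2(\mathbf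 A_{F,\mathrm f})$. The Harish-Chandra parameter $\lambda_\tau(\underline k,\underline t)$ of the weight is defined in the same way with $f(g,-)$ replaced by arbitrary holomorphic functions on $\mathfrak H_F$. 1. For every $\underline t\in\mathbf R^{\Sigma_F}$, every nonzero subrepresentation $\Pi\subseteq M_{\underline k,\underline t}$ and every infinite place $\tau$ of $E$, the Harish-Chandra parameter $\lambda_\tau$ of $\Pi$ exists and is equal to $\lambda_\tau(\underline k,\underline t)$, and $$\lambda_\tau^*\in X_\bullet(\hat T^*)\iff\sum_{\sigma\mid\tau}\left(t_\sigma-\tfrac12\right)\in\mathbf Z .$$ 2. There is a $\underline t\in\mathbf R^{\Sigma_F}$ such that $(\underline k,\underline t)$ is reasonable, i.e. $k_\sigma+2t_\sigma$ is independent of $\sigma\in\Sigma_F$, and such that $\lambda_\tau(\underline k,\underline t)^*\in X_\bullet(\hat T^*)$ for all infinite places $\tau$ of $E$, if and only if $\underline k$ is $E$-paritious, i.e. the parity of $\sum_{\sigma\mid\tau}k_\sigma$ is independent of the infinite place $\tau$ of $E$. -/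

import Mathlib

open scoped ContDiff TensorProduct
open NumberField

namespace Hilbert

noncomputable section

/-! ### Weights -/

section Weights

variable {F : Type*} [Field F]

/-- A weight is a family of integers indexed by the infinite places. -/
abbrev Weight (F : Type*) [Field F] := InfinitePlace F → ℤ

/-- The parity of the components of the weight is independent of the place. -/
def Paritious (k : Weight F) : Prop :=
  ∀ σ σ' : InfinitePlace F, k σ ≡ k σ' [ZMOD 2]

/-- The infinite places `σ` of `F` above the infinite place `τ` of `E`. -/
abbrev PlacesOver (F : Type*) [Field F] {E : Type*} [Field E] [Algebra E F]
    (τ : InfinitePlace E) :=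
  {σ : InfinitePlace F // σ.comap (algebraMap E F) = τ}

instance (F : Type*) [Field F] [NumberField F] {E : Type*} [Field E] [Algebra E F]
    (τ : InfinitePlace E) : Fintype (PlacesOver F τ) :=
  Fintype.ofFinite _

/-- The restriction `k_E` of a weight of `F` to `E`. -/
def Weight.restrict [NumberField F] (E : Type*) [Field E] [Algebra E F] (k : Weight F) :
    Weight E :=
  fun τ => ∑ σ : PlacesOver F τ, k σ

/-- `k` is `E`-paritious if `k_E` is paritious. -/
def EParitious [NumberField F] (E : Type*) [Field E] [Algebra E F] (k : Weight F) : Prop :=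
  Paritious (k.restrict E)

/-- `(k, t)` is reasonable if `k_σ + 2 t_σ` is independent of `σ`. -/
def Reasonable (k : Weight F) (t : InfinitePlace F → ℝ) : Prop :=
  ∀ σ σ' : InfinitePlace F, (k σ : ℝ) + 2 * t σ = (k σ' : ℝ) + 2 * t σ'

end Weights

/-! ### Smooth functions on `GL₂⁺(ℝ)^ι` and the action of the enveloping algebra -/

section Smooth

attribute [local instance 100] LieRing.ofAssociativeRing

variable (ι : Type*)

/-- `ι`-tuples of real `2 × 2` matrices. -/
abbrev RealMat := ι → Fin 2 → Fin 2 → ℝ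

/-- The group `GL₂⁺(ℝ)^ι`, as an open subset of the space of `ι`-tuples of matrices. -/
def glPos : Set (RealMat ι) := {g | ∀ i, 0 < (Matrix.of (g i)).det}

theorem isOpen_glPos [Finite ι] : IsOpen (glPos ι) := by
  have : glPos ι = ⋂ i, {g : RealMat ι | 0 < (Matrix.of (g i)).det} := by ext; simp [glPos]
  rw [this]
  refine isOpen_iInter_of_finite fun i => isOpen_lt continuous_const ?_
  simp only [Matrix.det_fin_two, Matrix.of_apply]
  fun_prop

variable {ι} in
/-- Matrix multiplication in each component. -/
def mulM (g A : RealMat ι) : RealMat ι := fun i a b => ∑ c, g i a c * A i c b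

variable {ι} in
/-- Multiplication by `A` on the right, as a linear map. -/
def mulRightM (A : RealMat ι) : RealMat ι →ₗ[ℝ] RealMat ι where
  toFun g := mulM g A
  map_add' g h := by ext i a b; simp [mulM]; ring
  map_smul' c g := by ext i a b; simp [mulM]; ring

variable [Fintype ι]

/-- The space `C^∞(GL₂⁺(ℝ)^ι, ℂ)`; functions on the group are extended by zero to all tuples
of matrices. -/
def SmoothFn : Submodule ℂ (RealMat ι → ℂ) where
  carrier := {φ | ContDiffOn ℝ ∞ φ (glPos ι) ∧ ∀ g ∉ glPos ι, φ g = 0}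
  add_mem' := fun ha hb => ⟨ha.1.add hb.1, fun g hg => by simp [ha.2 g hg, hb.2 g hg]⟩
  zero_mem' := ⟨contDiffOn_const, fun _ _ => rfl⟩
  smul_mem' := fun c _ ha => ⟨contDiffOn_const.smul ha.1, fun g hg => by simp [ha.2 g hg]⟩

variable {ι}

/-- The derivative of right translation by the real Lie algebra element `A`:
`(A φ)(g) = d/ds φ(g exp(sA))` at `s = 0`, i.e. the derivative of `φ` at `g` in direction `gA`. -/
def rightDeriv (A : RealMat ι) (φ : RealMat ι → ℂ) : RealMat ι → ℂ :=
  (glPos ι).indicator fun g => fderiv ℝ φ g (mulM g A)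

theorem hasFDerivAt_mulM (A g : RealMat ι) :
    HasFDerivAt (fun g : RealMat ι => mulM g A) (mulRightM A).toContinuousLinearMap g :=
  (mulRightM A).toContinuousLinearMap.hasFDerivAt

theorem contDiff_mulM (A : RealMat ι) : ContDiff ℝ ∞ fun g : RealMat ι => mulM g A :=
  (mulRightM A).toContinuousLinearMap.contDiff

theorem SmoothFn.contDiffAt {φ : RealMat ι → ℂ} (hφ : φ ∈ SmoothFn ι) {g : RealMat ι}
    (hg : g ∈ glPos ι) : ContDiffAt ℝ ∞ φ g :=
  hφ.1.contDiffAt ((isOpen_glPos ι).mem_nhds hg)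

theorem rightDeriv_mem (A : RealMat ι) {φ : RealMat ι → ℂ} (hφ : φ ∈ SmoothFn ι) :
    rightDeriv A φ ∈ SmoothFn ι := by
  refine ⟨?_, fun g hg => by simp [rightDeriv, hg]⟩
  have h : ContDiffOn ℝ ∞ (fun g => fderiv ℝ φ g (mulM g A)) (glPos ι) :=
    (hφ.1.fderiv_of_isOpen (isOpen_glPos ι) (by simp)).clm_apply
      (contDiff_mulM A).contDiffOn
  exact h.congr fun g hg => by simp [rightDeriv, hg]

theorem rightDeriv_apply {ι : Type*} [Fintype ι] (A : RealMat ι) (φ : RealMat ι → ℂ) {g : RealMat ι}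
    (hg : g ∈ glPos ι) : rightDeriv A φ g = fderiv ℝ φ g (mulM g A) := by
  simp [rightDeriv, hg]

/-- The operator `rightDeriv A` on smooth functions. -/
def realAction (A : RealMat ι) : Module.End ℂ (SmoothFn ι) where
  toFun φ := ⟨rightDeriv A φ, rightDeriv_mem A φ.2⟩
  map_add' φ ψ := by
    ext g
    by_cases hg : g ∈ glPos ι
    · have h1 := (SmoothFn.contDiffAt φ.2 hg).differentiableAt (by simp)
      have h2 := (SmoothFn.contDiffAt ψ.2 hg).differentiableAt (by simp)
      simp [rightDeriv_apply _ _ hg, fderiv_add h1 h2]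
    · simp [rightDeriv, hg]
  map_smul' c φ := by
    ext g
    by_cases hg : g ∈ glPos ι
    · have h1 := (SmoothFn.contDiffAt φ.2 hg).differentiableAt (by simp)
      simp [rightDeriv_apply _ _ hg, fderiv_const_smul h1]
    · simp [rightDeriv, hg]

theorem realAction_apply (A : RealMat ι) (φ : SmoothFn ι) {g : RealMat ι} (hg : g ∈ glPos ι) :
    (realAction A φ : RealMat ι → ℂ) g = fderiv ℝ (φ : RealMat ι → ℂ) g (mulM g A) :=
  rightDeriv_apply A φ hg

theorem SmoothFn.end_ext {S T : Module.End ℂ (SmoothFn ι)}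
    (h : ∀ φ : SmoothFn ι, ∀ g ∈ glPos ι, (S φ : RealMat ι → ℂ) g = (T φ : RealMat ι → ℂ) g) :
    S = T := by
  refine LinearMap.ext fun φ => Subtype.ext (funext fun g => ?_)
  by_cases hg : g ∈ glPos ι
  · exact h φ g hg
  · rw [(S φ).2.2 g hg, (T φ).2.2 g hg]

theorem realAction_add (A B : RealMat ι) : realAction (A + B) = realAction A + realAction B := by
  refine SmoothFn.end_ext fun φ g hg => ?_
  have : mulM g (A + B) = mulM g A + mulM g B := by ext i a b; simp [mulM]; ring
  simp [realAction_apply _ _ hg, this]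

theorem realAction_smul (c : ℝ) (A : RealMat ι) :
    realAction (c • A) = (c : ℂ) • realAction A := by
  refine SmoothFn.end_ext fun φ g hg => ?_
  have : mulM g (c • A) = c • mulM g A := by ext i a b; simp [mulM]; ring
  simp [realAction_apply _ _ hg, this]

theorem realAction_lie (A B : RealMat ι) :
    realAction (mulM A B - mulM B A) =
      realAction A * realAction B - realAction B * realAction A := by
  refine SmoothFn.end_ext fun φ g hg => ?_
  have hφ := SmoothFn.contDiffAt φ.2 hg
  have hd : DifferentiableAt ℝ (fderiv ℝ (φ : RealMat ι → ℂ)) g :=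
    (hφ.fderiv_right (m := 1) (by norm_cast)).differentiableAt (by simp)
  have key : ∀ A B : RealMat ι,
      (realAction A (realAction B φ) : RealMat ι → ℂ) g =
      fderiv ℝ (fderiv ℝ (φ : RealMat ι → ℂ)) g (mulM g A) (mulM g B) +
        fderiv ℝ (φ : RealMat ι → ℂ) g (mulM (mulM g A) B) := by
    intro A B
    have h1 : (realAction B φ : RealMat ι → ℂ) =ᶠ[nhds g]
        fun g => fderiv ℝ (φ : RealMat ι → ℂ) g (mulM g B) :=
      Filter.eventuallyEq_of_mem ((isOpen_glPos ι).mem_nhds hg)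
        fun x hx => rightDeriv_apply _ _ hx
    rw [realAction_apply _ _ hg, h1.fderiv_eq,
      (hd.hasFDerivAt.clm_apply (hasFDerivAt_mulM B g)).fderiv]
    simp [add_comm, mulRightM]
  have hs : IsSymmSndFDerivAt ℝ (φ : RealMat ι → ℂ) g :=
    hφ.isSymmSndFDerivAt (by simp; norm_cast)
  have hm : mulM g (mulM A B - mulM B A) = mulM (mulM g A) B - mulM (mulM g B) A := by
    ext i a b; simp [mulM]; ring
  simp only [LinearMap.sub_apply, Module.End.mul_apply, Submodule.coe_sub, Pi.sub_apply, key,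
    realAction_apply _ _ hg, hm, map_sub]
  rw [hs.eq (mulM g A) (mulM g B)]
  ring

variable (ι) in
/-- The complex Lie algebra `𝔤𝔩₂(ℂ)^ι`, the complexification of the Lie algebra of
`GL₂(ℝ)^ι`. -/
abbrev gl := ι → Matrix (Fin 2) (Fin 2) ℂ

def rePart {ι : Type*} (X : gl ι) : RealMat ι := fun i a b => (X i a b).re
def imPart {ι : Type*} (X : gl ι) : RealMat ι := fun i a b => (X i a b).im

theorem complexify_lie {A : Type*} [Ring A] [Algebra ℂ A] (a b c d : A) :
    a * c - c * a + ((-1 : ℝ) : ℂ) • (b * d - d * b) +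
      Complex.I • (a * d - d * a + (b * c - c * b)) =
    (a + Complex.I • b) * (c + Complex.I • d) - (c + Complex.I • d) * (a + Complex.I • b) := by
  have hI : ∀ x : A, Complex.I • Complex.I • x = -x := fun x => by
    rw [smul_smul, Complex.I_mul_I, neg_one_smul]
  simp only [add_mul, mul_add, smul_mul_assoc, mul_smul_comm, smul_add, hI]
  push_cast
  module

/-- The action of `𝔤𝔩₂(ℂ)^ι` on `C^∞(GL₂⁺(ℝ)^ι, ℂ)`, the complex linear extension of the action
of the real Lie algebra by derivatives of right translations. -/
def lieAction : gl ι →ₗ⁅ℂ⁆ Module.End ℂ (SmoothFn ι) where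
  toFun X := realAction (rePart X) + Complex.I • realAction (imPart X)
  map_add' X Y := by
    have h1 : rePart (X + Y) = rePart X + rePart Y := by ext; simp [rePart]
    have h2 : imPart (X + Y) = imPart X + imPart Y := by ext; simp [imPart]
    rw [h1, h2, realAction_add, realAction_add, smul_add]
    abel
  map_smul' c X := by
    have h1 : rePart (c • X) = c.re • rePart X + (-c.im) • imPart X := by
      ext; simp [rePart, imPart, sub_eq_add_neg]
    have h2 : imPart (c • X) = c.re • imPart X + c.im • rePart X := by
      ext; simp [rePart, imPart]
    rw [h1, h2]
    simp only [realAction_add, realAction_smul, RingHom.id_apply]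
    conv_rhs => rw [← Complex.re_add_im c]
    have hI : Complex.I * Complex.I = -1 := Complex.I_mul_I
    push_cast
    rw [smul_add, smul_add, smul_smul, smul_smul, smul_smul, add_mul, mul_assoc, hI]
    module
  map_lie' {X Y} := by
    have h1 : rePart ⁅X, Y⁆ = (mulM (rePart X) (rePart Y) - mulM (rePart Y) (rePart X)) +
        (-1 : ℝ) • (mulM (imPart X) (imPart Y) - mulM (imPart Y) (imPart X)) := by
      ext i a b
      simp [rePart, imPart, mulM, LieRing.of_associative_ring_bracket, Matrix.mul_apply]
      ring
    have h2 : imPart ⁅X, Y⁆ = (mulM (rePart X) (imPart Y) - mulM (imPart Y) (rePart X)) +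
        (mulM (imPart X) (rePart Y) - mulM (rePart Y) (imPart X)) := by
      ext i a b
      simp [rePart, imPart, mulM, LieRing.of_associative_ring_bracket, Matrix.mul_apply]
      ring
    rw [h1, h2, LieRing.of_associative_ring_bracket (realAction (rePart X) + _)]
    simp only [realAction_add, realAction_smul, realAction_lie]
    exact complexify_lie (A := Module.End ℂ (SmoothFn ι)) _ _ _ _

end Smooth

/-! ### Harish-Chandra parameters for `𝔤𝔩₂(ℂ)^κ` -/

section HarishChandra

attribute [local instance 100] LieRing.ofAssociativeRing

variable (κ : Type*)

/-- The enveloping algebra `U(𝔤)` of `𝔤 = 𝔤𝔩₂(ℂ)^κ`. -/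
abbrev Enveloping := UniversalEnvelopingAlgebra ℂ (gl κ)

/-- The Cartan subalgebra `𝔱` of diagonal matrices, as an abelian Lie algebra. -/
abbrev Cartan := κ → Fin 2 → ℂ

/-- The inclusion of `𝔱` into `𝔤`. -/
def diagHom : Cartan κ →ₗ⁅ℂ⁆ gl κ where
  toFun h := fun i => Matrix.diagonal (h i)
  map_add' h h' := by ext i a b; simp [Matrix.diagonal_apply]; split_ifs <;> simp
  map_smul' c h := by ext i a b; simp [Matrix.diagonal_apply]
  map_lie' {h h'} := by
    ext i a b
    simp [LieRing.of_associative_ring_bracket, Matrix.diagonal_apply, mul_comm]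

/-- The homomorphism `U(𝔱) → U(𝔤)`. -/
def cartanToEnveloping : UniversalEnvelopingAlgebra ℂ (Cartan κ) →ₐ[ℂ] Enveloping κ :=
  UniversalEnvelopingAlgebra.lift ℂ ((UniversalEnvelopingAlgebra.ι ℂ).comp (diagHom κ))

/-- The left ideal `U(𝔤) 𝔫`, with `𝔫` the strictly upper triangular matrices. -/
def nilIdeal : Ideal (Enveloping κ) :=
  Ideal.span {u | ∃ X : gl κ, (∀ i, X i 0 0 = 0 ∧ X i 1 0 = 0 ∧ X i 1 1 = 0) ∧
    u = UniversalEnvelopingAlgebra.ι ℂ X}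

variable {κ} in
/-- The character of the commutative algebra `U(𝔱) = S(𝔱)` defined by a linear form on `𝔱`. -/
def evalCartan (μ : Module.Dual ℂ (Cartan κ)) :
    UniversalEnvelopingAlgebra ℂ (Cartan κ) →ₐ[ℂ] ℂ :=
  UniversalEnvelopingAlgebra.lift ℂ
    { μ with
      map_lie' := fun {x y} => by
        have : ⁅x, y⁆ = 0 := by
          rw [LieRing.of_associative_ring_bracket, mul_comm, sub_self]
        simp [this, LieRing.of_associative_ring_bracket, mul_comm] }

/-- The lattice `X^•(T)` of characters of the diagonal torus `T` of `GL₂^κ`, in the standard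
basis. By definition of the dual group this is the lattice `X_•(T̂)`. -/
abbrev CharLattice := κ → Fin 2 → ℤ

variable [Fintype κ]

/-- Half the sum of the positive roots. -/
def rho : Module.Dual ℂ (Cartan κ) where
  toFun h := ∑ i, (h i 0 - h i 1) / 2
  map_add' h h' := by rw [← Finset.sum_add_distrib]; congr; ext; simp; ring
  map_smul' c h := by simp [Finset.mul_sum]; congr; ext; ring

/-- The differential of a character of `T`. -/
def charDifferential : CharLattice κ →ₗ[ℤ] Module.Dual ℂ (Cartan κ) where
  toFun χ :=
    { toFun := fun h => ∑ i, ∑ j, (χ i j : ℂ) * h i j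
      map_add' := fun h h' => by simp only [Pi.add_apply, mul_add, Finset.sum_add_distrib]
      map_smul' := fun c h => by
        simp only [Pi.smul_apply, smul_eq_mul, RingHom.id_apply, Finset.mul_sum, mul_left_comm] }
  map_add' χ χ' := by
    refine LinearMap.ext fun h => ?_
    simp only [LinearMap.coe_mk, AddHom.coe_mk, LinearMap.add_apply, Pi.add_apply, Int.cast_add,
      add_mul, Finset.sum_add_distrib]
  map_smul' c χ := by
    refine LinearMap.ext fun h => ?_
    simp only [LinearMap.coe_mk, AddHom.coe_mk, LinearMap.smul_apply, Pi.smul_apply, smul_eq_mul,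
      Int.cast_mul, zsmul_eq_mul, Finset.mul_sum, mul_assoc, eq_intCast, Int.cast_id]

variable {κ} in
/-- The identification of `X_•(T̂)_ℂ = X^•(T) ⊗ ℂ` with the dual of `𝔱`. -/
def toDual : ℂ ⊗[ℤ] CharLattice κ →ₗ[ℂ] Module.Dual ℂ (Cartan κ) :=
  (charDifferential κ).liftBaseChange ℂ

variable {κ} in
/-- Let `U(𝔤)` act on `V`. The centre of `U(𝔤)` acts on the vector `v` through the character with
Harish-Chandra parameter `lam`: if `z` is central and `p ∈ U(𝔱)` is congruent to `z` modulo
`U(𝔤) 𝔫`, then `z` acts on `v` by the value of `p` at `lam - ρ`. -/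
def HasHarishChandraParameter {V : Type*} [AddCommGroup V] [Module ℂ V]
    (act : Enveloping κ →ₐ[ℂ] Module.End ℂ V) (lam : ℂ ⊗[ℤ] CharLattice κ) (v : V) : Prop :=
  ∀ z ∈ Subalgebra.center ℂ (Enveloping κ), ∀ p : UniversalEnvelopingAlgebra ℂ (Cartan κ),
    z - cartanToEnveloping κ p ∈ nilIdeal κ →
      act z v = evalCartan (toDual lam - rho κ) p • v

end HarishChandra

/-! ### The group `G*` and the lattice `X_•(T̂*)` -/

section Star

variable (κ : Type*) [Fintype κ]

/-- The complex points of `G* ⊆ G` at an infinite place of `E` with `κ` the set of places of `F`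
above it: `G` becomes `GL₂^κ`, and `G*` is the subgroup where the determinant lies in the
diagonally embedded `GL₁`. -/
def GStar : Subgroup (κ → GL (Fin 2) ℂ) where
  carrier := {g | ∃ c : ℂˣ, ∀ i, (g i).det = c}
  mul_mem' := by
    rintro g h ⟨c, hc⟩ ⟨d, hd⟩
    exact ⟨c * d, fun i => by simp [hc, hd]⟩
  one_mem' := ⟨1, fun i => by simp⟩
  inv_mem' := by
    rintro g ⟨c, hc⟩
    exact ⟨c⁻¹, fun i => by simp [hc]⟩

variable {κ} in
/-- The element of the diagonal torus of `GL₂^κ` with the given entries. -/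
def torusElement (x : κ → Fin 2 → ℂˣ) : κ → GL (Fin 2) ℂ :=
  fun i => Units.map (Matrix.diagonalRingHom (Fin 2) ℂ).toMonoidHom (MulEquiv.piUnits.symm (x i))

variable {κ} in
/-- The value of a character of the diagonal torus. -/
def charEval (χ : CharLattice κ) (x : κ → Fin 2 → ℂˣ) : ℂˣ :=
  ∏ i, ∏ j, x i j ^ χ i j

/-- The characters of the diagonal torus `T` of `G` that are trivial on `T* = T ∩ G*`. -/
def starAnnihilator : Submodule ℤ (CharLattice κ) where
  carrier := {χ | ∀ x : κ → Fin 2 → ℂˣ, torusElement x ∈ GStar κ → charEval χ x = 1}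
  add_mem' := by
    intro χ χ' h h' x hx
    have e : charEval (χ + χ') x = charEval χ x * charEval χ' x := by
      simp only [charEval, Pi.add_apply, zpow_add, Finset.prod_mul_distrib]
    rw [e, h x hx, h' x hx, mul_one]
  zero_mem' := fun x _ => by simp [charEval]
  smul_mem' := by
    intro c χ h x hx
    have e : charEval (c • χ) x = charEval χ x ^ c := by
      simp only [charEval, Pi.smul_apply, smul_eq_mul, zpow_mul', Finset.prod_zpow]
    rw [e, h x hx, one_zpow]

/-- The lattice `X_•(T̂*)`, which by definition of the dual group is the character lattice
`X^•(T*)`: the quotient of `X^•(T)` by the characters that are trivial on `T*`. -/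
abbrev CocharStar := CharLattice κ ⧸ starAnnihilator κ

variable {κ} in
/-- The image `λ*` in `X_•(T̂*)_ℂ` of `λ ∈ X_•(T̂)_ℂ`. -/
def starImage (lam : ℂ ⊗[ℤ] CharLattice κ) : ℂ ⊗[ℤ] CocharStar κ :=
  (starAnnihilator κ).mkQ.baseChange ℂ lam

variable {κ} in
/-- An element of `X_•(T̂*)_ℂ` is integral if it comes from the lattice `X_•(T̂*)`. -/
def IsIntegralStar (lam : ℂ ⊗[ℤ] CocharStar κ) : Prop :=
  ∃ μ : CocharStar κ, lam = 1 ⊗ₜ[ℤ] μ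

end Star

/-! ### The weight `(k, t)` action and the passage to functions on the group -/

section Slash

open UpperHalfPlane

variable {ι : Type*} [Fintype ι]

/-- The weight `(k, t)` action of `γ ∈ GL₂⁺(ℝ)^ι` on functions on `ℍ^ι`. -/
def slash (k : ι → ℤ) (t : ι → ℝ) (h : (ι → ℍ) → ℂ) (γ : ι → GL (Fin 2) ℝ) (z : ι → ℍ) : ℂ :=
  (∏ i, (((γ i).det.val ^ ((k i : ℝ) + t i - 1) : ℝ) : ℂ)) *
    (∏ i, denom (γ i) (z i) ^ (-k i)) * h (fun i => γ i • z i)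

/-- Holomorphic functions on `ℍ^ι`. -/
def IsHolomorphic (h : (ι → ℍ) → ℂ) : Prop :=
  AnalyticOnNhd ℂ (fun w : ι → ℂ => h fun i => ofComplex (w i)) {w | ∀ i, 0 < (w i).im}

open Classical in
/-- The function `g ↦ (h |_{k,t} g)(i, …, i)` on `GL₂⁺(ℝ)^ι`. -/
def groupLift (k : ι → ℤ) (t : ι → ℝ) (h : (ι → ℍ) → ℂ) : RealMat ι → ℂ := fun g =>
  if hg : g ∈ glPos ι then
    slash k t h (fun i => Matrix.GeneralLinearGroup.mkOfDetNeZero (Matrix.of (g i)) (hg i).ne')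
      (fun _ => I)
  else 0

theorem groupLift_mem (k : ι → ℤ) (t : ι → ℝ) {h : (ι → ℍ) → ℂ} (hh : IsHolomorphic h) :
    groupLift k t h ∈ SmoothFn ι := by
  refine ⟨?_, fun g hg => by simp [groupLift, hg]⟩
  have hden : ∀ g ∈ glPos ι, ∀ i, (g i 1 0 : ℂ) * Complex.I + g i 1 1 ≠ 0 := by
    intro g hg i h0
    have h1 := congrArg Complex.re h0
    have h2 := congrArg Complex.im h0
    simp at h1 h2
    have := hg i
    simp [Matrix.det_fin_two, h1, h2] at this
  have him : ∀ g ∈ glPos ι, ∀ i, 0 < ((((g i 0 0 : ℝ) : ℂ) * Complex.I + g i 0 1) /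
      ((g i 1 0 : ℂ) * Complex.I + g i 1 1)).im := by
    intro g hg i
    have e := moebius_im (Matrix.GeneralLinearGroup.mkOfDetNeZero (Matrix.of (g i)) (hg i).ne')
      Complex.I
    have e2 := normSq_denom_pos (Matrix.GeneralLinearGroup.mkOfDetNeZero (Matrix.of (g i))
      (hg i).ne') (z := Complex.I) (by simp)
    have e3 : (0 : ℝ) < Complex.I.im := by simp
    exact (div_pos (mul_pos (hg i) e3) e2).trans_eq e.symm
  have hdet : ∀ i, ContDiff ℝ ∞ fun g : RealMat ι => (Matrix.of (g i)).det := by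
    intro i
    simp only [Matrix.det_fin_two, Matrix.of_apply]
    fun_prop
  have hcoe : ∀ i a b, ContDiff ℝ ∞ fun g : RealMat ι => ((g i a b : ℝ) : ℂ) := by
    intro i a b
    exact Complex.ofRealCLM.contDiff.comp (by fun_prop)
  have hlin : ∀ i a, ContDiff ℝ ∞ fun g : RealMat ι =>
      ((g i a 0 : ℝ) : ℂ) * Complex.I + ((g i a 1 : ℝ) : ℂ) :=
    fun i a => ((hcoe i a 0).mul contDiff_const).add (hcoe i a 1)
  have hH : ContDiffOn ℝ ∞ (fun w : ι → ℂ => h fun i => ofComplex (w i))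
      {w | ∀ i, 0 < (w i).im} :=
    ((hh.contDiffOn (n := ∞) (by
      have : {w : ι → ℂ | ∀ i, 0 < (w i).im} = ⋂ i, {w : ι → ℂ | 0 < (w i).im} := by
        ext; simp
      rw [this]
      exact (isOpen_iInter_of_finite fun i => isOpen_lt continuous_const
        (Complex.continuous_im.comp (continuous_apply i))).uniqueDiffOn))).restrict_scalars ℝ
  have main : ContDiffOn ℝ ∞ (fun g : RealMat ι =>
      (∏ i, (((Matrix.of (g i)).det ^ ((k i : ℝ) + t i - 1) : ℝ) : ℂ)) *
      (∏ i, (((g i 1 0 : ℝ) : ℂ) * Complex.I + ((g i 1 1 : ℝ) : ℂ)) ^ (-k i)) *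
      h (fun i => ofComplex ((((g i 0 0 : ℝ) : ℂ) * Complex.I + g i 0 1) /
        ((g i 1 0 : ℂ) * Complex.I + g i 1 1)))) (glPos ι) := by
    refine ContDiffOn.mul (ContDiffOn.mul ?_ ?_) ?_
    · refine contDiffOn_prod fun i _ => Complex.ofRealCLM.contDiff.comp_contDiffOn ?_
      exact (hdet i).contDiffOn.rpow_const_of_ne fun g hg => (hg i).ne'
    · refine contDiffOn_prod fun i _ => ?_
      intro g hg
      have hz : ContDiffAt ℝ ∞ (fun w : ℂ => w ^ (-k i))
          (((g i 1 0 : ℝ) : ℂ) * Complex.I + ((g i 1 1 : ℝ) : ℂ)) :=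
        (((analyticAt_id (𝕜 := ℂ)).zpow (hden g hg i)).contDiffAt (n := ∞)).restrict_scalars ℝ
      exact (hz.comp g (hlin i 1).contDiffAt).contDiffWithinAt
    · refine ContDiffOn.comp (t := {w | ∀ i, 0 < (w i).im}) (f := fun (g : RealMat ι) i =>
        (((g i 0 0 : ℝ) : ℂ) * Complex.I + g i 0 1) / ((g i 1 0 : ℂ) * Complex.I + g i 1 1))
        hH ?_ fun g hg i => him g hg i
      refine contDiffOn_pi.2 fun i => ?_
      simp only [div_eq_mul_inv]
      exact (hlin i 0).contDiffOn.mul ((hlin i 1).contDiffOn.inv fun g hg => hden g hg i)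
  refine main.congr fun g hg => ?_
  have hsm : ∀ i, (Matrix.GeneralLinearGroup.mkOfDetNeZero (Matrix.of (g i)) (hg i).ne') • I =
      ofComplex ((((g i 0 0 : ℝ) : ℂ) * Complex.I + g i 0 1) /
        ((g i 1 0 : ℂ) * Complex.I + g i 1 1)) := by
    intro i
    rw [ofComplex_apply_of_im_pos (him g hg i)]
    exact glPos_smul_def (g := Matrix.GeneralLinearGroup.mkOfDetNeZero (Matrix.of (g i))
      (hg i).ne') (hg i) I
  simp only [groupLift, hg, dif_pos, slash, hsm]
  rfl

/-- `groupLift` as an element of the space of smooth functions. -/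
def smoothLift (k : ι → ℤ) (t : ι → ℝ) (h : (ι → ℍ) → ℂ) (hh : IsHolomorphic h) : SmoothFn ι :=
  ⟨groupLift k t h, groupLift_mem k t hh⟩

end Slash

/-! ### Hilbert modular forms -/

section Forms

open UpperHalfPlane

variable (F : Type*) [Field F] [NumberField F] [IsTotallyReal F]

/-- The ring of finite adeles of `F`. -/
abbrev FinAdele := IsDedekindDomain.FiniteAdeleRing (𝓞 F) F

variable {F} in
/-- The embedding of `F` into the real numbers given by an infinite place. -/
def realEmbedding (σ : InfinitePlace F) : F →+* ℝ :=
  InfinitePlace.embedding_of_isReal (IsTotallyReal.isReal σ)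

variable {F} in
/-- The image of `γ ∈ GL₂(F)` in `GL₂(ℝ)^{Σ_F}`. -/
def toReal (γ : GL (Fin 2) F) : InfinitePlace F → GL (Fin 2) ℝ :=
  fun σ => Matrix.GeneralLinearGroup.map (realEmbedding σ) γ

/-- The image of `γ ∈ GL₂(F)` in `GL₂` of the finite adeles. -/
def toFinAdele (γ : GL (Fin 2) F) : GL (Fin 2) (FinAdele F) :=
  Matrix.GeneralLinearGroup.map (algebraMap F (FinAdele F)) γ

variable {F} in
/-- Hilbert modular forms of weight `(k, t)`. If `F = ℚ`, holomorphy at the cusps is expressed by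
boundedness of all `f(g, ·)` near `i∞`. -/
structure IsHilbertModularForm (k : Weight F) (t : InfinitePlace F → ℝ)
    (f : GL (Fin 2) (FinAdele F) → (InfinitePlace F → ℍ) → ℂ) : Prop where
  holo : ∀ g, IsHolomorphic (f g)
  modular : ∀ γ : GL (Fin 2) F, (∀ σ, 0 < (toReal γ σ).det.val) → ∀ g,
    f (toFinAdele F γ * g) = slash k t (f g) (toReal γ⁻¹)
  level : ∃ U : Subgroup (GL (Fin 2) (FinAdele F)), IsOpen (U : Set (GL (Fin 2) (FinAdele F))) ∧
    IsCompact (U : Set (GL (Fin 2) (FinAdele F))) ∧ ∀ u ∈ U, ∀ g, f (g * u) = f g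
  cusps : Module.finrank ℚ F = 1 → ∀ g, ∃ A B : ℝ, ∀ z : InfinitePlace F → ℍ,
    (∀ σ, A ≤ (z σ).im) → ‖f g z‖ ≤ B

variable {F}

/-- A space of Hilbert modular forms of weight `(k, t)` stable under right translation by `GL₂` of
the finite adeles, i.e. a `GL₂(𝔸_{F,f})`-subrepresentation of `M_{k,t}`. -/
structure IsSubrepresentation (k : Weight F) (t : InfinitePlace F → ℝ)
    (Pi : Submodule ℂ (GL (Fin 2) (FinAdele F) → (InfinitePlace F → ℍ) → ℂ)) : Prop where
  forms : ∀ f ∈ Pi, IsHilbertModularForm k t f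
  translate : ∀ f ∈ Pi, ∀ u : GL (Fin 2) (FinAdele F), (fun g => f (g * u)) ∈ Pi

end Forms

/-! ### Harish-Chandra parameters of Hilbert modular forms -/

section Parameters

attribute [local instance 100] LieRing.ofAssociativeRing

open UpperHalfPlane

variable {F : Type*} [Field F] [NumberField F] {E : Type*} [Field E] [Algebra E F]

open Classical in
/-- The inclusion of `𝔤_τ = ∏_{σ ∣ τ} 𝔤𝔩₂(ℂ)` into `∏_σ 𝔤𝔩₂(ℂ)`. -/
def placeInclusion (F : Type*) [Field F] [NumberField F] [Algebra E F] (τ : InfinitePlace E) :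
    gl (PlacesOver F τ) →ₗ⁅ℂ⁆ gl (InfinitePlace F) where
  toFun X := fun σ => if h : σ.comap (algebraMap E F) = τ then X ⟨σ, h⟩ else 0
  map_add' X Y := by
    funext σ
    by_cases h : σ.comap (algebraMap E F) = τ <;> simp [h]
  map_smul' c X := by
    funext σ
    by_cases h : σ.comap (algebraMap E F) = τ <;> simp [h]
  map_lie' {X Y} := by
    funext σ
    by_cases h : σ.comap (algebraMap E F) = τ <;>
      simp [h, LieRing.of_associative_ring_bracket]

/-- The action of `U(𝔤_τ)` on smooth functions on `GL₂⁺(F ⊗ ℝ)`. -/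
def placeAction (F : Type*) [Field F] [NumberField F] [Algebra E F] (τ : InfinitePlace E) :
    Enveloping (PlacesOver F τ) →ₐ[ℂ] Module.End ℂ (SmoothFn (InfinitePlace F)) :=
  UniversalEnvelopingAlgebra.lift ℂ (lieAction.comp (placeInclusion F τ))

/-- `lam` is (a representative of the Weyl group orbit which is) the Harish-Chandra parameter of
the component at `τ` of the automorphic representation of `G(𝔸_E) = GL₂(𝔸_F)` defined by `Pi`: the
centre of `U(𝔤_τ)` acts on the automorphic forms `(g, g_∞) ↦ (f(g, ·) |_{k,t} g_∞)(i)`, for `f` in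
`Pi`, through the character with parameter `lam`. -/
def IsHarishChandraParameter [IsTotallyReal F] (k : Weight F) (t : InfinitePlace F → ℝ)
    (Pi : Submodule ℂ (GL (Fin 2) (FinAdele F) → (InfinitePlace F → ℍ) → ℂ))
    (τ : InfinitePlace E) (lam : ℂ ⊗[ℤ] CharLattice (PlacesOver F τ)) : Prop :=
  ∀ f ∈ Pi, ∀ (hf : IsHilbertModularForm k t f) (g : GL (Fin 2) (FinAdele F)),
    HasHarishChandraParameter (placeAction F τ) lam (smoothLift k t (f g) (hf.holo g))

/-- `lam` is (a representative of) the Harish-Chandra parameter at `τ` belonging to the weight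
`(k, t)`: the centre of `U(𝔤_τ)` acts through the character with parameter `lam` on
the functions `g ↦ (h |_{k,t} g)(i)` on `GL₂⁺(F ⊗ ℝ)`, for all holomorphic `h`. -/
def IsWeightHarishChandraParameter (k : Weight F) (t : InfinitePlace F → ℝ) (τ : InfinitePlace E)
    (lam : ℂ ⊗[ℤ] CharLattice (PlacesOver F τ)) : Prop :=
  ∀ (h : (InfinitePlace F → ℍ) → ℂ) (hh : IsHolomorphic h),
    HasHarishChandraParameter (placeAction F τ) lam (smoothLift k t h hh)

end Parameters

end

end Hilbert

open Hilbert

/-! The function on the group attached to a holomorphic `h` extends to complex matrices near the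
real ones, as a product of powers of determinants, powers of denominators and the value of `h` at
the Möbius images of `i`. Let `X` have `(i, 1)` as eigenvector in each component, with eigenvalues
`ξ`. Moving from `g` to `g(1 + uX)` leaves the Möbius images of `i` unchanged, so only determinants
and denominators vary, and `X` acts by the scalar `∑ ((k + t - 1) tr X - k ξ)`
(`lieAction_smoothLift`). Holomorphy thus makes the function a highest weight vector for the Borel
subalgebra that stabilises the line of `(i, 1)`.

That Borel subalgebra is the image of the upper triangular one under `Ad(exp N)` with `N` nilpotent,
and `Ad(exp N)` fixes the centre of the enveloping algebra (`cayleyConj_of_mem_center`). The central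
character is therefore that of the highest weight `(t - 1, k + t - 1)`; adding `ρ` gives the
parameter `(t - 1/2, k + t - 3/2)`. It does not depend on `h`, so a single nonzero form already
detects it. Conversely the trace and Casimir elements recover the two coordinates at each place up
to order (`IsWeightHarishChandraParameter.coords`).

The two coordinates differ by an integer, so integrality of `λ*` does not see the order. On `T*` the
determinants of all components coincide, hence `λ*` is an integral element plus `∑ (t - 1/2)` times
this common determinant character, which gives the criterion of the first part
(`isIntegralStar_starImage_ofCoords`).

For the second part, put `w = k + 2t`. Then `∑ (t - 1/2)` over the places above `τ` is `((w -
1)[F:E] - k_E(τ)) / 2`, because every `τ` has `[F:E]` places above it (`card_placesOver`).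
Integrality at all `τ` forces the `k_E(τ)` to be congruent modulo 2, and if they are, some real `w`
works for all `τ` at once. -/

namespace Hilbert

noncomputable section

/-! ### Enveloping algebras: conjugation by a unipotent element fixes the centre -/

section Enveloping

attribute [local instance 100] LieRing.ofAssociativeRing

open UniversalEnvelopingAlgebra Polynomial

/-- Induction principle: the universal property gives a retraction onto the subalgebra, and its
composite with the inclusion is the identity on generators. -/
theorem mem_of_ι_mem {K L : Type*} [CommRing K] [LieRing L] [LieAlgebra K L]
    (S : Subalgebra K (UniversalEnvelopingAlgebra K L))
    (h : ∀ x : L, UniversalEnvelopingAlgebra.ι K x ∈ S)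
    (u : UniversalEnvelopingAlgebra K L) : u ∈ S := by
  let f : L →ₗ⁅K⁆ S :=
    { toFun := fun x => ⟨UniversalEnvelopingAlgebra.ι K x, h x⟩
      map_add' := fun x y => Subtype.ext (map_add _ x y)
      map_smul' := fun c x => Subtype.ext (map_smul _ c x)
      map_lie' := fun {x y} => Subtype.ext (LieHom.map_lie _ x y) }
  have e : S.val.comp (lift K f) = AlgHom.id K _ := by
    refine hom_ext K (LieHom.ext fun x => ?_)
    change ((lift K f (UniversalEnvelopingAlgebra.ι K x) : S) : UniversalEnvelopingAlgebra K L) =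
      UniversalEnvelopingAlgebra.ι K x
    rw [lift_ι_apply]
    rfl
  have e' : ((lift K f u : S) : UniversalEnvelopingAlgebra K L) = u := congrArg (fun φ => φ u) e
  exact e' ▸ (lift K f u).2

theorem mem_center_iff_ι {K L : Type*} [CommRing K] [LieRing L] [LieAlgebra K L]
    {z : UniversalEnvelopingAlgebra K L} :
    z ∈ Subalgebra.center K (UniversalEnvelopingAlgebra K L) ↔
      ∀ x : L, UniversalEnvelopingAlgebra.ι K x * z = z * UniversalEnvelopingAlgebra.ι K x := by
  rw [Subalgebra.mem_center_iff]
  refine ⟨fun h x => h _, fun h u => ?_⟩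
  have := mem_of_ι_mem (Subalgebra.centralizer K {z})
    (fun x => Subalgebra.mem_centralizer_iff K |>.2 fun y hy => by
      rw [Set.mem_singleton_iff.1 hy]; exact (h x).symm) u
  exact ((Subalgebra.mem_centralizer_iff K).1 this z rfl).symm

/-- Evaluation of a polynomial over a possibly noncommutative algebra at a scalar. -/
def evalScalar {K A : Type*} [CommRing K] [Ring A] [Algebra K A] (s : K) : A[X] →ₐ[K] A :=
  Polynomial.eval₂AlgHom (AlgHom.id K A) (algebraMap K A s) fun a => (Algebra.commutes s a).symm

theorem evalScalar_C {K A : Type*} [CommRing K] [Ring A] [Algebra K A] (s : K) (a : A) :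
    evalScalar s (C a) = a :=
  eval₂_C _ _

theorem evalScalar_X {K A : Type*} [CommRing K] [Ring A] [Algebra K A] (s : K) :
    evalScalar s (X : A[X]) = algebraMap K A s :=
  eval₂_X _ _

/-- A polynomial one-parameter family of homomorphisms from `U(L)` to itself that starts at the
identity and whose infinitesimal generator is `ad x` fixes every element that commutes with
`x`. -/
theorem evalScalar_lift_of_commute {K L : Type*} [Field K] [CharZero K] [LieRing L]
    [LieAlgebra K L] (x : L) (f : L →ₗ⁅K⁆ (UniversalEnvelopingAlgebra K L)[X])
    (hf : ∀ y, derivative (f y) = f ⁅x, y⁆)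
    (h0 : ∀ y, evalScalar (0 : K) (f y) = UniversalEnvelopingAlgebra.ι K y)
    (s : K) {z : UniversalEnvelopingAlgebra K L}
    (hz : UniversalEnvelopingAlgebra.ι K x * z = z * UniversalEnvelopingAlgebra.ι K x) :
    evalScalar s (lift K f z) = z := by
  set D : UniversalEnvelopingAlgebra K L → UniversalEnvelopingAlgebra K L := fun u =>
    UniversalEnvelopingAlgebra.ι K x * u - u * UniversalEnvelopingAlgebra.ι K x with hD
  -- Write `φ_s` for the family. The condition `d/ds φ_s(u) = φ_s([x, u])` is stable under products
  -- because both sides obey the Leibniz rule along `φ_s`, so the generators suffice. If `x`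
  -- commutes with `z`, then `φ_s(z)` has derivative zero; it is constant and equal to its value `z`
  -- at `s = 0`.
  let S : Subalgebra K (UniversalEnvelopingAlgebra K L) :=
    { carrier := {u | derivative (lift K f u) = lift K f (D u)}
      mul_mem' := by
        intro a b (ha : _ = _) (hb : _ = _)
        have : D (a * b) = D a * b + a * D b := by simp only [hD]; noncomm_ring
        simp only [Set.mem_ofPred_eq, map_mul, derivative_mul, ha, hb, this, map_add]
      add_mem' := by
        intro a b (ha : _ = _) (hb : _ = _)
        have : D (a + b) = D a + D b := by simp only [hD]; noncomm_ring
        simp only [Set.mem_ofPred_eq, map_add, ha, hb, this]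
      algebraMap_mem' := by
        intro r
        have : D (algebraMap K _ r) = 0 := by
          simp only [hD]; rw [Algebra.commutes, sub_self]
        simp only [Set.mem_ofPred_eq, this, map_zero, AlgHom.commutes]
        rw [Polynomial.algebraMap_apply, derivative_C] }
  have key : z ∈ S := by
    refine mem_of_ι_mem S (fun y => ?_) z
    change derivative (lift K f _) = lift K f _
    have : D (UniversalEnvelopingAlgebra.ι K y) = UniversalEnvelopingAlgebra.ι K ⁅x, y⁆ := by
      rw [LieHom.map_lie, LieRing.of_associative_ring_bracket]
    rw [this, lift_ι_apply, lift_ι_apply, hf]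
  have hzero : derivative (lift K f z) = 0 := by
    have : derivative (lift K f z) = lift K f (D z) := key
    rw [this, hD]
    simp only [hz, sub_self, map_zero]
  have hid : (evalScalar (0 : K)).comp (lift K f) = AlgHom.id K _ := by
    refine hom_ext K (LieHom.ext fun y => ?_)
    change evalScalar (0 : K) (lift K f (UniversalEnvelopingAlgebra.ι K y)) = _
    rw [lift_ι_apply, h0]
    rfl
  have hid' : evalScalar (0 : K) (lift K f z) = z := congrArg (fun φ => φ z) hid
  -- Characteristic zero enters here: a polynomial with zero derivative is constant only if the
  -- coefficients have no torsion.
  have : IsAddTorsionFree (UniversalEnvelopingAlgebra K L) :=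
    IsAddTorsionFree.of_isTorsionFree K _
  have hc := eq_C_of_derivative_eq_zero hzero
  rw [hc, evalScalar_C] at hid' ⊢
  exact hid'

/-- The nilpotent element `N` of `𝔤𝔩₂(ℂ)^κ` such that `exp N` carries the line spanned by `(1, 0)` to
the line spanned by `(i, 1)` in each component. -/
def cayleyNil (κ : Type*) : gl κ := fun _ => !![0, 0; -Complex.I, 0]

theorem cayleyNil_mul_self (κ : Type*) : cayleyNil κ * cayleyNil κ = 0 := by
  ext i a b
  fin_cases a <;> fin_cases b <;> simp [cayleyNil, Matrix.mul_apply]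

/-- Compatibility of `Ad(exp sN)` with brackets, compared by powers of `s`. The hypotheses say that
the coefficients of `s ^ 3` and `s ^ 4` vanish. -/
theorem bracket_quadratic {A : Type*} [Ring A] (y y₁ y₂ z z₁ z₂ : A)
    (h3 : y₁ * z₂ - z₂ * y₁ + (y₂ * z₁ - z₁ * y₂) = 0) (h4 : y₂ * z₂ - z₂ * y₂ = 0) :
    C (y * z - z * y) + X * (C (y₁ * z - z * y₁) + C (y * z₁ - z₁ * y)) -
      X ^ 2 * (C (y₂ * z - z * y₂) - C (y₁ * z₁ - z₁ * y₁) + C (y * z₂ - z₂ * y)) =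
    (C y + X * C y₁ - X ^ 2 * C y₂) * (C z + X * C z₁ - X ^ 2 * C z₂) -
      (C z + X * C z₁ - X ^ 2 * C z₂) * (C y + X * C y₁ - X ^ 2 * C y₂) := by
  have h3' := congrArg (C : A → A[X]) h3
  have h4' := congrArg (C : A → A[X]) h4
  have hX : ∀ (a : A) (p : A[X]), C a * (X * p) = X * (C a * p) := fun a p => by
    rw [← mul_assoc, ← X_mul_C, mul_assoc]
  simp only [C_mul, C_add, C_sub, C_0] at h3' h4' ⊢
  simp only [mul_add, add_mul, mul_sub, sub_mul, pow_two, mul_assoc, hX] at h3' h4' ⊢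
  linear_combination (norm := noncomm_ring) X * X * X * h3' - X * X * X * X * h4'

/-- Conjugation by `exp (s N)`, as a polynomial in `s`. -/
def cayleyFamily (κ : Type*) : gl κ →ₗ⁅ℂ⁆ (Enveloping κ)[X] where
  toFun Y := C (UniversalEnvelopingAlgebra.ι ℂ Y) +
    X * C (UniversalEnvelopingAlgebra.ι ℂ ⁅cayleyNil κ, Y⁆) -
    X ^ 2 * C (UniversalEnvelopingAlgebra.ι ℂ (cayleyNil κ * Y * cayleyNil κ))
  map_add' Y Z := by
    simp only [lie_add, mul_add, add_mul, map_add]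
    abel
  map_smul' c Y := by
    simp only [lie_smul, mul_smul_comm, smul_mul_assoc, map_smul, ← Polynomial.smul_C, smul_add,
      smul_sub, RingHom.id_apply]
  map_lie' {Y Z} := by
    have hN := cayleyNil_mul_self κ
    set N := cayleyNil κ
    have hN' : ∀ A : gl κ, N * (N * A) = 0 := fun A => by rw [← mul_assoc, hN, zero_mul]
    -- Since `N ^ 2 = 0`, conjugation by `exp(sN)` sends `Y` to `Y + s[N, Y] - s ^ 2 NYN`. The
    -- identities `h1` to `h4` compare the coefficients of `s`, `s ^ 2`, `s ^ 3`, `s ^ 4` in the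
    -- bracket of two such expressions.
    have h1 : ⁅N, ⁅Y, Z⁆⁆ = ⁅⁅N, Y⁆, Z⁆ + ⁅Y, ⁅N, Z⁆⁆ := leibniz_lie N Y Z
    have h2 : N * ⁅Y, Z⁆ * N = ⁅N * Y * N, Z⁆ - ⁅⁅N, Y⁆, ⁅N, Z⁆⁆ + ⁅Y, N * Z * N⁆ := by
      simp only [LieRing.of_associative_ring_bracket, mul_sub, sub_mul, mul_assoc, hN',
        mul_zero]
      abel
    have h3 : ⁅⁅N, Y⁆, N * Z * N⁆ + ⁅N * Y * N, ⁅N, Z⁆⁆ = 0 := by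
      simp only [LieRing.of_associative_ring_bracket, mul_sub, sub_mul, mul_assoc, hN',
        mul_zero]
      abel
    have h4 : ⁅N * Y * N, N * Z * N⁆ = 0 := by
      simp only [LieRing.of_associative_ring_bracket, mul_assoc, hN', mul_zero, sub_self]
    rw [h1, h2]
    generalize ⁅N, Y⁆ = Y₁ at *
    generalize ⁅N, Z⁆ = Z₁ at *
    generalize N * Y * N = Y₂ at *
    generalize N * Z * N = Z₂ at *
    have h3' := congrArg (UniversalEnvelopingAlgebra.ι ℂ) h3
    have h4' := congrArg (UniversalEnvelopingAlgebra.ι ℂ) h4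
    simp only [map_add, map_sub, map_zero, LieHom.map_lie] at h3' h4' ⊢
    simp only [LieRing.of_associative_ring_bracket] at h3' h4' ⊢
    exact bracket_quadratic _ _ _ _ _ _ h3' h4'

theorem cayleyFamily_apply {κ : Type*} (Y : gl κ) :
    cayleyFamily κ Y = C (UniversalEnvelopingAlgebra.ι ℂ Y) +
      X * C (UniversalEnvelopingAlgebra.ι ℂ ⁅cayleyNil κ, Y⁆) -
      X ^ 2 * C (UniversalEnvelopingAlgebra.ι ℂ (cayleyNil κ * Y * cayleyNil κ)) :=
  rfl

theorem derivative_quadratic {A : Type*} [Ring A] (y y₁ y₂ : A) :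
    derivative (C y + X * C y₁ - X ^ 2 * C y₂) = C y₁ + X * C (-(y₂ + y₂)) - X ^ 2 * C 0 := by
  rw [pow_two, derivative_sub, derivative_add, derivative_mul, derivative_mul, derivative_mul,
    derivative_X, derivative_C, derivative_C, derivative_C, C_neg, C_add, C_0]
  noncomm_ring

theorem derivative_cayleyFamily (κ : Type*) (Y : gl κ) :
    derivative (cayleyFamily κ Y) = cayleyFamily κ ⁅cayleyNil κ, Y⁆ := by
  have hN := cayleyNil_mul_self κ
  have hN' : ∀ A : gl κ, cayleyNil κ * (cayleyNil κ * A) = 0 := fun A => by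
    rw [← mul_assoc, hN, zero_mul]
  have h1 : ⁅cayleyNil κ, ⁅cayleyNil κ, Y⁆⁆ =
      -(cayleyNil κ * Y * cayleyNil κ + cayleyNil κ * Y * cayleyNil κ) := by
    simp only [LieRing.of_associative_ring_bracket, mul_sub, sub_mul, mul_assoc, hN', hN,
      mul_zero]
    abel
  have h2 : cayleyNil κ * ⁅cayleyNil κ, Y⁆ * cayleyNil κ = 0 := by
    simp only [LieRing.of_associative_ring_bracket, mul_sub, sub_mul, mul_assoc, hN', hN,
      mul_zero, zero_mul, sub_self]
  rw [cayleyFamily_apply, cayleyFamily_apply, h1, h2, map_neg, map_add, map_zero,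
    derivative_quadratic]

/-- The endomorphism of `U(𝔤𝔩₂(ℂ)^κ)` induced by conjugation with `exp N`. -/
def cayleyConj (κ : Type*) : Enveloping κ →ₐ[ℂ] Enveloping κ :=
  (evalScalar (1 : ℂ)).comp (lift ℂ (cayleyFamily κ))

theorem cayleyConj_ι {κ : Type*} (Y : gl κ) :
    cayleyConj κ (UniversalEnvelopingAlgebra.ι ℂ Y) =
      UniversalEnvelopingAlgebra.ι ℂ
        (Y + ⁅cayleyNil κ, Y⁆ - cayleyNil κ * Y * cayleyNil κ) := by
  change evalScalar (1 : ℂ) (lift ℂ (cayleyFamily κ) (UniversalEnvelopingAlgebra.ι ℂ Y)) = _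
  rw [lift_ι_apply, cayleyFamily_apply]
  simp only [map_add, map_sub, map_mul, map_pow, evalScalar_C, evalScalar_X, map_one, one_pow,
    one_mul]

/-- The family `Ad(exp sN)` is polynomial in `s` with generator `ad N`, and central elements are
killed by `ad N`. -/
theorem cayleyConj_of_mem_center {κ : Type*} {z : Enveloping κ}
    (hz : z ∈ Subalgebra.center ℂ (Enveloping κ)) : cayleyConj κ z = z := by
  refine evalScalar_lift_of_commute (cayleyNil κ) (cayleyFamily κ) (derivative_cayleyFamily κ)
    (fun Y => ?_) 1 (mem_center_iff_ι.1 hz _)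
  rw [cayleyFamily_apply]
  simp only [map_add, map_sub, map_mul, map_pow, evalScalar_C, evalScalar_X, map_zero, zero_mul,
    zero_pow two_ne_zero, add_zero, sub_zero]

end Enveloping

/-! ### Complex directional derivatives of the functions attached to holomorphic functions -/

section ComplexLift

attribute [local instance 100] LieRing.ofAssociativeRing

open UpperHalfPlane

variable {ι : Type*}

/-- The extension of `groupLift k t h` to a holomorphic function of tuples of complex matrices. -/
def complexLift [Fintype ι] (k : ι → ℤ) (t : ι → ℝ) (h : (ι → ℍ) → ℂ) (G : ι → Fin 2 → Fin 2 → ℂ) : ℂ :=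
  (∏ i, (G i 0 0 * G i 1 1 - G i 0 1 * G i 1 0) ^ ((k i : ℂ) + t i - 1)) *
    (∏ i, (G i 1 0 * Complex.I + G i 1 1) ^ (-k i)) *
    h (fun i => ofComplex ((G i 0 0 * Complex.I + G i 0 1) / (G i 1 0 * Complex.I + G i 1 1)))

/-- The inclusion of real matrices into complex matrices. -/
def ofRealMat (ι : Type*) [Fintype ι] : RealMat ι →L[ℝ] (ι → Fin 2 → Fin 2 → ℂ) :=
  LinearMap.toContinuousLinearMap
    { toFun := fun g i a b => (g i a b : ℂ)
      map_add' := fun g h => by ext; simp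
      map_smul' := fun c g => by ext; simp }

theorem ofRealMat_apply [Fintype ι] (g : RealMat ι) (i : ι) (a b : Fin 2) :
    ofRealMat ι g i a b = (g i a b : ℂ) := rfl

theorem denom_ne_zero_of_mem_glPos {g : RealMat ι} (hg : g ∈ glPos ι) (i : ι) :
    (g i 1 0 : ℂ) * Complex.I + g i 1 1 ≠ 0 := by
  intro h0
  have h1 := congrArg Complex.re h0
  have h2 := congrArg Complex.im h0
  simp at h1 h2
  have := hg i
  simp [Matrix.det_fin_two, h1, h2] at this

theorem moebius_im_pos_of_mem_glPos {g : RealMat ι} (hg : g ∈ glPos ι) (i : ι) :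
    0 < (((g i 0 0 : ℂ) * Complex.I + g i 0 1) / ((g i 1 0 : ℂ) * Complex.I + g i 1 1)).im := by
  have e := moebius_im (Matrix.GeneralLinearGroup.mkOfDetNeZero (Matrix.of (g i)) (hg i).ne')
    Complex.I
  have e2 := normSq_denom_pos (Matrix.GeneralLinearGroup.mkOfDetNeZero (Matrix.of (g i))
    (hg i).ne') (z := Complex.I) (by simp)
  have e3 : (0 : ℝ) < Complex.I.im := by simp
  exact (div_pos (mul_pos (hg i) e3) e2).trans_eq e.symm

theorem ofReal_det_eq (g : RealMat ι) (i : ι) :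
    (g i 0 0 : ℂ) * g i 1 1 - g i 0 1 * g i 1 0 = ((Matrix.of (g i)).det : ℂ) := by
  simp [Matrix.det_fin_two]

variable [Fintype ι]

/-- The principal branch of the complex power agrees with the real power because the determinants
are positive. -/
theorem groupLift_eq_complexLift (k : ι → ℤ) (t : ι → ℝ) (h : (ι → ℍ) → ℂ) {g : RealMat ι}
    (hg : g ∈ glPos ι) : groupLift k t h g = complexLift k t h (ofRealMat ι g) := by
  have hsm : ∀ i, (Matrix.GeneralLinearGroup.mkOfDetNeZero (Matrix.of (g i)) (hg i).ne') • I =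
      ofComplex ((((g i 0 0 : ℝ) : ℂ) * Complex.I + g i 0 1) /
        ((g i 1 0 : ℂ) * Complex.I + g i 1 1)) := by
    intro i
    rw [ofComplex_apply_of_im_pos (moebius_im_pos_of_mem_glPos hg i)]
    exact glPos_smul_def (g := Matrix.GeneralLinearGroup.mkOfDetNeZero (Matrix.of (g i))
      (hg i).ne') (hg i) I
  have hdet : ∀ i, (((Matrix.of (g i)).det ^ ((k i : ℝ) + t i - 1) : ℝ) : ℂ) =
      ((g i 0 0 : ℂ) * g i 1 1 - g i 0 1 * g i 1 0) ^ ((k i : ℂ) + t i - 1) := by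
    intro i
    rw [ofReal_det_eq, Complex.ofReal_cpow (hg i).le]
    push_cast
    rfl
  simp only [groupLift, hg, dif_pos, slash, hsm, complexLift, ofRealMat_apply, ← hdet]
  rfl

theorem differentiableAt_prod {α V : Type*} [NormedAddCommGroup V] [NormedSpace ℂ V]
    (s : Finset α) {f : α → V → ℂ} {x : V} (hf : ∀ i, DifferentiableAt ℂ (f i) x) :
    DifferentiableAt ℂ (fun v => ∏ i ∈ s, f i v) x := by
  classical
  induction s using Finset.induction_on with
  | empty => simp
  | insert a s ha ih =>
    simp only [Finset.prod_insert ha]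
    exact (hf a).mul ih

/-- At points of `glPos` the determinants avoid the branch cut, the denominators are nonzero and the
Möbius images of `i` lie in the upper half plane. -/
theorem differentiableAt_complexLift (k : ι → ℤ) (t : ι → ℝ) {h : (ι → ℍ) → ℂ}
    (hh : IsHolomorphic h) {g : RealMat ι} (hg : g ∈ glPos ι) :
    DifferentiableAt ℂ (complexLift k t h) (ofRealMat ι g) := by
  have hlin : ∀ i a, DifferentiableAt ℂ
      (fun G : ι → Fin 2 → Fin 2 → ℂ => G i a 0 * Complex.I + G i a 1) (ofRealMat ι g) :=
    fun i a => by fun_prop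
  refine ((differentiableAt_prod _ fun i => ?_).mul (differentiableAt_prod _ fun i => ?_)).mul ?_
  · refine DifferentiableAt.cpow_const (by fun_prop) ?_
    simp only [ofRealMat_apply, ofReal_det_eq]
    exact Complex.ofReal_mem_slitPlane.2 (hg i)
  · exact (hlin i 1).zpow (Or.inl (denom_ne_zero_of_mem_glPos hg i))
  · have hH : DifferentiableAt ℂ (fun w : ι → ℂ => h fun i => ofComplex (w i))
        (fun i => (ofRealMat ι g i 0 0 * Complex.I + ofRealMat ι g i 0 1) /
          (ofRealMat ι g i 1 0 * Complex.I + ofRealMat ι g i 1 1)) :=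
      (hh _ fun i => moebius_im_pos_of_mem_glPos hg i).differentiableAt
    refine DifferentiableAt.comp (ofRealMat ι g) (g := fun w : ι → ℂ => h fun i => ofComplex (w i))
      (f := fun (G : ι → Fin 2 → Fin 2 → ℂ) i =>
        (G i 0 0 * Complex.I + G i 0 1) / (G i 1 0 * Complex.I + G i 1 1)) hH ?_
    refine differentiableAt_pi.2 fun i => ?_
    have hne : ofRealMat ι g i 1 0 * Complex.I + ofRealMat ι g i 1 1 ≠ 0 :=
      denom_ne_zero_of_mem_glPos hg i
    simp only [div_eq_mul_inv]
    exact (hlin i 0).mul (DifferentiableAt.inv (hlin i 1) hne)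

theorem fderiv_groupLift (k : ι → ℤ) (t : ι → ℝ) {h : (ι → ℍ) → ℂ}
    (hh : IsHolomorphic h) {g : RealMat ι} (hg : g ∈ glPos ι) (v : RealMat ι) :
    fderiv ℝ (groupLift k t h) g v =
      fderiv ℂ (complexLift k t h) (ofRealMat ι g) (ofRealMat ι v) := by
  have h1 : groupLift k t h =ᶠ[nhds g] complexLift k t h ∘ ofRealMat ι :=
    Filter.eventuallyEq_of_mem ((isOpen_glPos ι).mem_nhds hg)
      fun x hx => groupLift_eq_complexLift k t h hx
  have h2 := ((differentiableAt_complexLift k t hh hg).hasFDerivAt.restrictScalars ℝ).comp g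
    (ofRealMat ι).hasFDerivAt
  rw [h1.fderiv_eq, h2.fderiv]
  rfl

/-- The real derivative of the lift is the restriction of a complex linear map, so the real and
imaginary parts of `X` recombine into the single direction `gX`. -/
theorem lieAction_smoothLift_apply (k : ι → ℤ) (t : ι → ℝ) {h : (ι → ℍ) → ℂ}
    (hh : IsHolomorphic h) {g : RealMat ι} (hg : g ∈ glPos ι) (X : gl ι) :
    (lieAction X (smoothLift k t h hh) : RealMat ι → ℂ) g =
      fderiv ℂ (complexLift k t h) (ofRealMat ι g)
        (fun i a b => ∑ c, (g i a c : ℂ) * X i c b) := by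
  have e : (fun i a b => ∑ c, (g i a c : ℂ) * X i c b) =
      ofRealMat ι (mulM g (rePart X)) + Complex.I • ofRealMat ι (mulM g (imPart X)) := by
    funext i a b
    simp only [Pi.add_apply, Pi.smul_apply, ofRealMat_apply, mulM, smul_eq_mul,
      Complex.ofReal_sum, Complex.ofReal_mul, Finset.mul_sum, ← Finset.sum_add_distrib, rePart,
      imPart]
    refine Finset.sum_congr rfl fun c _ => ?_
    conv_lhs => rw [← Complex.re_add_im (X i c b)]
    ring
  rw [e, map_add, map_smul, ← fderiv_groupLift k t hh hg, ← fderiv_groupLift k t hh hg,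
    ← rightDeriv_apply _ _ hg, ← rightDeriv_apply _ _ hg]
  rfl

theorem hasDerivAt_prod_of_logarithmic {α : Type*} (s : Finset α) {f : α → ℂ → ℂ}
    {c : α → ℂ} {x : ℂ} (hf : ∀ i, HasDerivAt (f i) (c i * f i x) x) :
    HasDerivAt (fun u => ∏ i ∈ s, f i u) ((∑ i ∈ s, c i) * ∏ i ∈ s, f i x) x := by
  classical
  induction s using Finset.induction_on with
  | empty => simpa using hasDerivAt_const x (1 : ℂ)
  | insert a s ha ih =>
    simp only [Finset.prod_insert ha, Finset.sum_insert ha]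
    exact ((hf a).mul ih).congr_deriv (by ring)

/-- An element of `𝔤𝔩₂(ℂ)^ι` for which `(i, 1)` is an eigenvector in each component acts on
`g ↦ (h |_{k,t} g)(i, …, i)` by a scalar. -/
theorem lieAction_smoothLift (k : ι → ℤ) (t : ι → ℝ) {h : (ι → ℍ) → ℂ}
    (hh : IsHolomorphic h) (X : gl ι) (ξ : ι → ℂ)
    (h0 : ∀ i, X i 0 0 * Complex.I + X i 0 1 = ξ i * Complex.I)
    (h1 : ∀ i, X i 1 0 * Complex.I + X i 1 1 = ξ i) :
    lieAction X (smoothLift k t h hh) =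
      (∑ i, (((k i : ℂ) + t i - 1) * (X i 0 0 + X i 1 1) - k i * ξ i)) •
        smoothLift k t h hh := by
  refine Subtype.ext (funext fun g => ?_)
  by_cases hg : g ∈ glPos ι
  swap
  · rw [(lieAction X (smoothLift k t h hh)).2.2 g hg, ((_ : ℂ) • smoothLift k t h hh).2.2 g hg]
  rw [lieAction_smoothLift_apply k t hh hg]
  change _ = _ * groupLift k t h g
  rw [groupLift_eq_complexLift k t h hg]
  set V : ι → Fin 2 → Fin 2 → ℂ := fun i a b => ∑ c, (g i a c : ℂ) * X i c b with hV
  -- On the line `u ↦ g(1 + uX)`, `D` is the determinant and `J` the denominator at `i`. As `X(i, 1)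
  -- = ξ(i, 1)`, numerator and denominator are both multiplied by `1 + uξ`.
  set D : ι → ℂ → ℂ := fun i u =>
    ((Matrix.of (g i)).det * (1 + u * (X i 0 0 + X i 1 1) +
      u ^ 2 * (X i 0 0 * X i 1 1 - X i 0 1 * X i 1 0)))
  set J : ι → ℂ → ℂ := fun i u => ((g i 1 0 : ℂ) * Complex.I + g i 1 1) * (1 + u * ξ i)
  have hline : HasDerivAt (fun u : ℂ => ofRealMat ι g + u • V) V 0 := by
    simpa using ((hasDerivAt_id (0 : ℂ)).smul_const V).const_add (ofRealMat ι g)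
  have hcomp : HasDerivAt (fun u : ℂ => complexLift k t h (ofRealMat ι g + u • V))
      (fderiv ℂ (complexLift k t h) (ofRealMat ι g) V) 0 := by
    have hd : HasFDerivAt (complexLift k t h) (fderiv ℂ (complexLift k t h) (ofRealMat ι g))
        (ofRealMat ι g + (0 : ℂ) • V) := by
      simpa using (differentiableAt_complexLift k t hh hg).hasFDerivAt
    exact hd.comp_hasDerivAt (0 : ℂ) hline
  have hnum : ∀ i a (u : ℂ), (ofRealMat ι g + u • V) i a 0 * Complex.I +
      (ofRealMat ι g + u • V) i a 1 = ((g i a 0 : ℂ) * Complex.I + g i a 1) * (1 + u * ξ i) := by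
    intro i a u
    simp only [Pi.add_apply, Pi.smul_apply, ofRealMat_apply, hV, Fin.sum_univ_two, smul_eq_mul]
    linear_combination u * g i a 0 * h0 i + u * g i a 1 * h1 i
  have hdet : ∀ i (u : ℂ), (ofRealMat ι g + u • V) i 0 0 * (ofRealMat ι g + u • V) i 1 1 -
      (ofRealMat ι g + u • V) i 0 1 * (ofRealMat ι g + u • V) i 1 0 = D i u := by
    intro i u
    simp only [D, ← ofReal_det_eq]
    simp only [Pi.add_apply, Pi.smul_apply, ofRealMat_apply, hV, Fin.sum_univ_two, smul_eq_mul]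
    ring
  have hD0 : ∀ i, D i 0 ∈ Complex.slitPlane := fun i => by
    simpa [D] using hg i
  have hD : ∀ i, HasDerivAt (fun u => D i u ^ ((k i : ℂ) + t i - 1))
      (((k i : ℂ) + t i - 1) * (X i 0 0 + X i 1 1) * D i 0 ^ ((k i : ℂ) + t i - 1)) 0 := by
    intro i
    have hd : HasDerivAt (D i) ((Matrix.of (g i)).det * (X i 0 0 + X i 1 1)) 0 := by
      have := ((((hasDerivAt_id (0 : ℂ)).mul_const (X i 0 0 + X i 1 1)).const_add 1).add
        (((hasDerivAt_id (0 : ℂ)).pow 2).mul_const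
          (X i 0 0 * X i 1 1 - X i 0 1 * X i 1 0))).const_mul ((Matrix.of (g i)).det : ℂ)
      simpa using this
    refine (hd.cpow_const (c := (k i : ℂ) + t i - 1) (hD0 i)).congr_deriv ?_
    rw [Complex.cpow_sub _ _ (Complex.slitPlane_ne_zero (hD0 i)), Complex.cpow_one]
    have : D i 0 = (Matrix.of (g i)).det := by simp [D]
    rw [this]
    have hne : ((Matrix.of (g i)).det : ℂ) ≠ 0 := by exact_mod_cast (hg i).ne'
    field_simp
  have hJ : ∀ i, HasDerivAt (fun u => J i u ^ (-k i)) (-(k i : ℂ) * ξ i * J i 0 ^ (-k i)) 0 := by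
    intro i
    have hne := denom_ne_zero_of_mem_glPos hg i
    have hj : HasDerivAt (J i) (((g i 1 0 : ℂ) * Complex.I + g i 1 1) * ξ i) 0 := by
      have := (((hasDerivAt_id (0 : ℂ)).mul_const (ξ i)).const_add 1).const_mul
        ((g i 1 0 : ℂ) * Complex.I + g i 1 1)
      simpa using this
    have hJ0 : J i 0 = (g i 1 0 : ℂ) * Complex.I + g i 1 1 := by simp [J]
    have hz := (hasDerivAt_zpow (-k i) (J i 0) (Or.inl (hJ0 ▸ hne))).comp (0 : ℂ) hj
    refine hz.congr_deriv ?_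
    rw [hJ0, zpow_sub_one₀ hne]
    push_cast
    field_simp
  have hmain : HasDerivAt (fun u : ℂ => (∏ i, D i u ^ ((k i : ℂ) + t i - 1)) *
      (∏ i, J i u ^ (-k i)) * h (fun i => ofComplex (((g i 0 0 : ℂ) * Complex.I + g i 0 1) /
        ((g i 1 0 : ℂ) * Complex.I + g i 1 1))))
      ((∑ i, (((k i : ℂ) + t i - 1) * (X i 0 0 + X i 1 1) - k i * ξ i)) *
        complexLift k t h (ofRealMat ι g)) 0 := by
    refine (((hasDerivAt_prod_of_logarithmic Finset.univ hD).mul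
      (hasDerivAt_prod_of_logarithmic Finset.univ hJ)).mul_const (h (fun i => ofComplex
        (((g i 0 0 : ℂ) * Complex.I + g i 0 1) /
          ((g i 1 0 : ℂ) * Complex.I + g i 1 1))))).congr_deriv ?_
    have hc : complexLift k t h (ofRealMat ι g) = (∏ i, D i 0 ^ ((k i : ℂ) + t i - 1)) *
      (∏ i, J i 0 ^ (-k i)) * h (fun i => ofComplex (((g i 0 0 : ℂ) * Complex.I + g i 0 1) /
        ((g i 1 0 : ℂ) * Complex.I + g i 1 1))) := by
      simp only [complexLift, ofRealMat_apply, ofReal_det_eq, D, J]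
      simp
    rw [hc, Finset.sum_sub_distrib]
    simp only [neg_mul, Finset.sum_neg_distrib]
    ring
  refine hcomp.unique (hmain.congr_of_eventuallyEq ?_)
  -- For small `u` the factor `1 + uξ` is nonzero and cancels, so the argument of `h` is constant
  -- near `u = 0`.
  have hev : ∀ᶠ u : ℂ in nhds 0, ∀ i, 1 + u * ξ i ≠ 0 := by
    refine Filter.eventually_all.2 fun i => ?_
    have : ContinuousAt (fun u : ℂ => 1 + u * ξ i) 0 := by fun_prop
    exact this.eventually_ne (by simp)
  filter_upwards [hev] with u hu
  simp only [complexLift, hnum, hdet]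
  simp only [J, mul_div_mul_right _ _ (hu _)]

end ComplexLift

/-! ### Central characters of highest weight vectors -/

section HighestWeight

attribute [local instance 100] LieRing.ofAssociativeRing

open UniversalEnvelopingAlgebra

theorem evalCartan_ι {κ : Type*} (μ : Module.Dual ℂ (Cartan κ)) (h : Cartan κ) :
    evalCartan μ (UniversalEnvelopingAlgebra.ι ℂ h) = μ h :=
  lift_ι_apply ..

theorem cartanToEnveloping_ι {κ : Type*} (h : Cartan κ) :
    cartanToEnveloping κ (UniversalEnvelopingAlgebra.ι ℂ h) =
      UniversalEnvelopingAlgebra.ι ℂ (diagHom κ h) :=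
  lift_ι_apply ..

variable {κ : Type*} [Fintype κ] {V : Type*} [AddCommGroup V] [Module ℂ V]

/-- The centre acts on a highest weight vector through the character given by the weight. -/
theorem hasHarishChandraParameter_of_highestWeight (act : Enveloping κ →ₐ[ℂ] Module.End ℂ V)
    (lam : ℂ ⊗[ℤ] CharLattice κ) (v : V)
    (hn : ∀ X : gl κ, (∀ i, X i 0 0 = 0 ∧ X i 1 0 = 0 ∧ X i 1 1 = 0) →
      act (UniversalEnvelopingAlgebra.ι ℂ X) v = 0)
    (ht : ∀ h : Cartan κ, act (UniversalEnvelopingAlgebra.ι ℂ (diagHom κ h)) v =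
      (toDual lam - rho κ) h • v) :
    HasHarishChandraParameter act lam v := by
  intro z _ p hp
  have hnil : ∀ u ∈ nilIdeal κ, act u v = 0 := by
    intro u hu
    refine Submodule.span_induction ?_ (by simp) (fun x y _ _ hx hy => ?_)
      (fun a x _ hx => ?_) hu
    · rintro _ ⟨X, hX, rfl⟩
      exact hn X hX
    · rw [map_add, LinearMap.add_apply, hx, hy, add_zero]
    · rw [smul_eq_mul, map_mul, Module.End.mul_apply, hx, map_zero]
  -- The vector is a common eigenvector of the Cartan subalgebra, so the elements of `U(𝔱)` acting
  -- on it through evaluation form a subalgebra containing the generators.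
  let S : Subalgebra ℂ (UniversalEnvelopingAlgebra ℂ (Cartan κ)) :=
    { carrier := {q | act (cartanToEnveloping κ q) v = evalCartan (toDual lam - rho κ) q • v}
      mul_mem' := by
        intro a b (ha : _ = _) (hb : _ = _)
        simp only [Set.mem_ofPred_eq, map_mul, Module.End.mul_apply, hb, map_smul, ha, smul_smul]
        rw [mul_comm]
      add_mem' := by
        intro a b (ha : _ = _) (hb : _ = _)
        simp only [Set.mem_ofPred_eq, map_add, LinearMap.add_apply, ha, hb, add_smul]
      algebraMap_mem' := by
        intro r
        simp only [Set.mem_ofPred_eq, AlgHom.commutes, Module.algebraMap_end_apply]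
        rfl }
  have hS : p ∈ S := mem_of_ι_mem S (fun h => by
    change act (cartanToEnveloping κ _) v = _ • v
    rw [cartanToEnveloping_ι, evalCartan_ι, ht]) p
  have e := hnil _ hp
  rw [map_sub, LinearMap.sub_apply, sub_eq_zero] at e
  exact e.trans hS

/-- Only the action of central elements matters, and these are fixed by the conjugation; a highest
weight vector for the conjugate Borel subalgebra is as good as one for the upper triangular one. -/
theorem HasHarishChandraParameter.of_comp_cayleyConj {act : Enveloping κ →ₐ[ℂ] Module.End ℂ V}
    {lam : ℂ ⊗[ℤ] CharLattice κ} {v : V}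
    (h : HasHarishChandraParameter (act.comp (cayleyConj κ)) lam v) :
    HasHarishChandraParameter act lam v := by
  intro z hz p hp
  have := h z hz p hp
  rwa [AlgHom.comp_apply, cayleyConj_of_mem_center hz] at this

end HighestWeight

/-! ### Coordinates on `X^•(T) ⊗ ℂ` -/

section Coordinates

variable {κ : Type*} [Fintype κ]

open Classical in
/-- The element of `X^•(T) ⊗ ℂ` with the given coordinates. -/
def ofCoords (c : κ → Fin 2 → ℂ) : ℂ ⊗[ℤ] CharLattice κ :=
  ∑ i, ∑ j, c i j ⊗ₜ[ℤ] (Pi.single i (Pi.single j 1) : CharLattice κ)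

theorem toDual_tmul (c : ℂ) (χ : CharLattice κ) (h : Cartan κ) :
    toDual (c ⊗ₜ[ℤ] χ) h = c * ∑ i, ∑ j, (χ i j : ℂ) * h i j := by
  simp only [toDual, LinearMap.liftBaseChange_tmul, LinearMap.smul_apply, smul_eq_mul]
  rfl

theorem toDual_ofCoords (c : κ → Fin 2 → ℂ) (h : Cartan κ) :
    toDual (ofCoords c) h = ∑ i, ∑ j, c i j * h i j := by
  classical
  simp only [ofCoords, map_sum, LinearMap.sum_apply, toDual_tmul]
  refine Finset.sum_congr rfl fun i _ => Finset.sum_congr rfl fun j _ => ?_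
  congr 1
  rw [Finset.sum_eq_single i, Finset.sum_eq_single j]
  · simp
  · intro b _ hb; simp [hb]
  · simp
  · intro b _ hb; simp [hb]
  · simp

theorem exists_eq_ofCoords (lam : ℂ ⊗[ℤ] CharLattice κ) : ∃ c, lam = ofCoords c := by
  classical
  induction lam using TensorProduct.induction_on with
  | zero => exact ⟨0, by simp [ofCoords]⟩
  | tmul c χ =>
    refine ⟨fun i j => c * χ i j, ?_⟩
    have hχ : χ = ∑ i, ∑ j, χ i j • (Pi.single i (Pi.single j 1) : CharLattice κ) := by
      funext a b
      simp only [Finset.sum_apply, Pi.smul_apply]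
      rw [Finset.sum_eq_single a, Finset.sum_eq_single b]
      · simp
      · intro b' _ hb; simp [hb.symm]
      · simp
      · intro b' _ hb; simp [hb.symm]
      · simp
    conv_lhs => rw [hχ]
    simp only [ofCoords, TensorProduct.tmul_sum]
    refine Finset.sum_congr rfl fun i _ => Finset.sum_congr rfl fun j _ => ?_
    rw [← TensorProduct.smul_tmul, zsmul_eq_mul, mul_comm]
  | add x y hx hy =>
    obtain ⟨a, rfl⟩ := hx
    obtain ⟨b, rfl⟩ := hy
    refine ⟨a + b, ?_⟩
    simp only [ofCoords, Pi.add_apply, TensorProduct.add_tmul, Finset.sum_add_distrib]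

end Coordinates

/-! ### The parameter of the weight `(k, t)` -/

section WeightParameter

attribute [local instance 100] LieRing.ofAssociativeRing

open UniversalEnvelopingAlgebra UpperHalfPlane

variable {F : Type*} [Field F] [NumberField F] {E : Type*} [Field E] [Algebra E F]

theorem placeAction_ι (τ : InfinitePlace E) (X : gl (PlacesOver F τ)) :
    placeAction F τ (UniversalEnvelopingAlgebra.ι ℂ X) = lieAction (placeInclusion F τ X) :=
  lift_ι_apply ..

/-- The Harish-Chandra parameter at `τ` of the weight `(k, t)`. -/
def weightParameter (k : Weight F) (t : InfinitePlace F → ℝ) (τ : InfinitePlace E) :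
    ℂ ⊗[ℤ] CharLattice (PlacesOver F τ) :=
  ofCoords fun σ => ![(t σ : ℂ) - 1 / 2, (k σ : ℂ) + t σ - 3 / 2]

/-- Upper triangular matrices, conjugated by `exp N`, act on the functions attached to holomorphic
functions by scalars. -/
theorem placeAction_cayleyConj_ι (k : Weight F) (t : InfinitePlace F → ℝ) (τ : InfinitePlace E)
    {h : (InfinitePlace F → ℍ) → ℂ} (hh : IsHolomorphic h) (X : gl (PlacesOver F τ))
    (hX : ∀ σ, X σ 1 0 = 0) :
    placeAction F τ (cayleyConj _ (UniversalEnvelopingAlgebra.ι ℂ X)) (smoothLift k t h hh) =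
      (∑ σ : PlacesOver F τ, (((k σ : ℂ) + t σ - 1) * (X σ 0 0 + X σ 1 1) - k σ * X σ 0 0)) •
        smoothLift k t h hh := by
  classical
  rw [cayleyConj_ι, placeAction_ι]
  set Y := X + ⁅cayleyNil (PlacesOver F τ), X⁆ -
    cayleyNil (PlacesOver F τ) * X * cayleyNil (PlacesOver F τ) with hY
  have hYσ : ∀ σ, Y σ = !![X σ 0 0 + Complex.I * X σ 0 1, X σ 0 1;
      -Complex.I * X σ 0 0 + Complex.I * X σ 1 1 + X σ 0 1,
      X σ 1 1 - Complex.I * X σ 0 1] := by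
    intro σ
    have hI : Complex.I * Complex.I = -1 := Complex.I_mul_I
    have hXσ := Matrix.eta_fin_two (X σ)
    rw [hX] at hXσ
    change X σ + (!![0, 0; -Complex.I, 0] * X σ - X σ * !![0, 0; -Complex.I, 0]) -
      !![0, 0; -Complex.I, 0] * X σ * !![0, 0; -Complex.I, 0] = _
    generalize X σ 0 0 = x at *
    generalize X σ 0 1 = y at *
    generalize X σ 1 1 = w at *
    rw [hXσ]
    ext a b
    fin_cases a <;> fin_cases b <;> simp
    · ring
    · linear_combination -y * hI
    · ring
  have hI : Complex.I * Complex.I = -1 := Complex.I_mul_I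
  -- `exp N` sends `(1, 0)` to `-i(i, 1)`, so `(i, 1)` is an eigenvector of `Y` whose eigenvalue is
  -- the upper left entry of `X`. At places not above `τ` the element is zero and contributes
  -- nothing.
  rw [lieAction_smoothLift k t hh (placeInclusion F τ Y)
    (fun σ => if hσ : σ.comap (algebraMap E F) = τ then X ⟨σ, hσ⟩ 0 0 else 0)]
  · congr 1
    refine (Fintype.sum_of_injective Subtype.val Subtype.val_injective _ _ ?_ ?_).symm
    · intro σ hσ
      have hσ' : ¬ σ.comap (algebraMap E F) = τ := fun h => hσ ⟨⟨σ, h⟩, rfl⟩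
      simp [placeInclusion, hσ']
    · intro σ
      simp only [placeInclusion, LieHom.coe_mk, σ.2, dif_pos, hYσ]
      simp
  · intro σ
    by_cases hσ : σ.comap (algebraMap E F) = τ
    · simp only [placeInclusion, LieHom.coe_mk, hσ, dif_pos, hYσ]
      simp
      linear_combination X ⟨σ, hσ⟩ 0 1 * hI
    · simp [placeInclusion, hσ]
  · intro σ
    by_cases hσ : σ.comap (algebraMap E F) = τ
    · simp only [placeInclusion, LieHom.coe_mk, hσ, dif_pos, hYσ]
      simp
      linear_combination (X ⟨σ, hσ⟩ 1 1 - X ⟨σ, hσ⟩ 0 0) * hI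
    · simp [placeInclusion, hσ]

theorem isWeightHarishChandraParameter_weightParameter (k : Weight F) (t : InfinitePlace F → ℝ)
    (τ : InfinitePlace E) :
    IsWeightHarishChandraParameter k t τ (weightParameter k t τ) := by
  intro h hh
  refine HasHarishChandraParameter.of_comp_cayleyConj
    (hasHarishChandraParameter_of_highestWeight _ _ _ (fun X hX => ?_) fun d => ?_)
  · rw [AlgHom.comp_apply, placeAction_cayleyConj_ι k t τ hh X fun σ => (hX σ).2.1]
    simp [hX]
  · rw [AlgHom.comp_apply, placeAction_cayleyConj_ι k t τ hh (diagHom _ d)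
      fun σ => by simp [diagHom]]
    -- The diagonal matrix `d` acts by `∑ ((t - 1) d₀ + (k + t - 1) d₁)`, which is `λ - ρ` for `λ =
    -- (t - 1/2, k + t - 3/2)`.
    congr 1
    rw [LinearMap.sub_apply, weightParameter, toDual_ofCoords]
    change _ = _ - ∑ i, (d i 0 - d i 1) / 2
    rw [← Finset.sum_sub_distrib]
    refine Finset.sum_congr rfl fun σ _ => ?_
    simp [diagHom, Fin.sum_univ_two]
    ring

end WeightParameter

/-! ### Trace and Casimir elements -/

section Casimir

attribute [local instance 100] LieRing.ofAssociativeRing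

open UniversalEnvelopingAlgebra

/-- The element `y` stands for the matrix `!![p, b; c, s]` with `a = p - s`. After the Leibniz rule
for `ad y`, the remaining terms cancel by the commutators of `h` with `e` and `f`. Writing the
Casimir element with `e` on the right makes it congruent to `h ^ 2 + 2h` modulo `U(𝔤) 𝔫`. -/
theorem casimir_commute {A : Type*} [Ring A] [Algebra ℂ A] (e f h y : A) (a b c : ℂ)
    (hhe : h * e - e * h = (2 : ℂ) • e) (hhf : h * f - f * h = -(2 : ℂ) • f)
    (hyh : y * h - h * y = (2 * c) • f + (-(2 * b)) • e)
    (hye : y * e - e * y = a • e + (-c) • h) (hyf : y * f - f * y = b • h + (-a) • f) :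
    y * (h * h + (2 : ℂ) • h + (4 : ℂ) • (f * e)) =
      (h * h + (2 : ℂ) • h + (4 : ℂ) • (f * e)) * y := by
  linear_combination (norm := skip) hyh * h + h * hyh + (2 : ℂ) • hyh + (4 : ℂ) • (hyf * e) +
    (4 : ℂ) • (f * hye) + (2 * b) • hhe + (2 * c) • hhf
  simp only [mul_add, add_mul, mul_sub, sub_mul, smul_mul_assoc, mul_smul_comm, mul_assoc,
    smul_sub, smul_smul]
  module

variable {κ : Type*}

open Classical in
/-- The element of `𝔤𝔩₂(ℂ)^κ` with the given component at `i` and `0` elsewhere. -/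
def glSingle (i : κ) (M : Matrix (Fin 2) (Fin 2) ℂ) : gl κ := Pi.single i M

theorem lie_glSingle (Y : gl κ) (i : κ) (M : Matrix (Fin 2) (Fin 2) ℂ) :
    ⁅Y, glSingle i M⁆ = glSingle i (Y i * M - M * Y i) := by
  classical
  funext j
  by_cases hj : j = i
  · subst hj
    simp [glSingle, LieRing.of_associative_ring_bracket]
  · simp [glSingle, LieRing.of_associative_ring_bracket, Pi.single_eq_of_ne hj]

theorem ι_glSingle_smul (i : κ) (M : Matrix (Fin 2) (Fin 2) ℂ) (a : ℂ) :
    UniversalEnvelopingAlgebra.ι ℂ (glSingle i (a • M)) =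
      a • UniversalEnvelopingAlgebra.ι ℂ (glSingle i M) := by
  classical
  rw [← map_smul, glSingle, glSingle, Pi.single_smul]

theorem ι_glSingle_add (i : κ) (M M' : Matrix (Fin 2) (Fin 2) ℂ) :
    UniversalEnvelopingAlgebra.ι ℂ (glSingle i (M + M')) =
      UniversalEnvelopingAlgebra.ι ℂ (glSingle i M) +
        UniversalEnvelopingAlgebra.ι ℂ (glSingle i M') := by
  classical
  rw [← map_add, glSingle, glSingle, glSingle, Pi.single_add]

theorem commutator_ι_glSingle (Y : gl κ) (i : κ) (M : Matrix (Fin 2) (Fin 2) ℂ) :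
    UniversalEnvelopingAlgebra.ι ℂ Y * UniversalEnvelopingAlgebra.ι ℂ (glSingle i M) -
      UniversalEnvelopingAlgebra.ι ℂ (glSingle i M) * UniversalEnvelopingAlgebra.ι ℂ Y =
    UniversalEnvelopingAlgebra.ι ℂ (glSingle i (Y i * M - M * Y i)) := by
  rw [← lie_glSingle, LieHom.map_lie, LieRing.of_associative_ring_bracket]

theorem ι_glSingle_one_mem_center (i : κ) :
    UniversalEnvelopingAlgebra.ι ℂ (glSingle i 1) ∈
      Subalgebra.center ℂ (Enveloping κ) := by
  classical
  refine mem_center_iff_ι.2 fun Y => sub_eq_zero.1 ?_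
  rw [commutator_ι_glSingle, mul_one, one_mul, sub_self, glSingle, Pi.single_zero, map_zero]

/-- The Casimir element of the component at `i`. -/
def casimir (i : κ) : Enveloping κ :=
  UniversalEnvelopingAlgebra.ι ℂ (glSingle i !![1, 0; 0, -1]) *
      UniversalEnvelopingAlgebra.ι ℂ (glSingle i !![1, 0; 0, -1]) +
    (2 : ℂ) • UniversalEnvelopingAlgebra.ι ℂ (glSingle i !![1, 0; 0, -1]) +
    (4 : ℂ) • (UniversalEnvelopingAlgebra.ι ℂ (glSingle i !![0, 0; 1, 0]) *
      UniversalEnvelopingAlgebra.ι ℂ (glSingle i !![0, 1; 0, 0]))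

theorem casimir_mem_center (i : κ) : casimir i ∈ Subalgebra.center ℂ (Enveloping κ) := by
  refine mem_center_iff_ι.2 fun Y => ?_
  have hY := Matrix.eta_fin_two (Y i)
  have hs : (glSingle i !![1, 0; 0, -1] : gl κ) i = !![1, 0; 0, -1] := by simp [glSingle]
  refine casimir_commute _ _ _ _ (Y i 0 0 - Y i 1 1) (Y i 0 1) (Y i 1 0) ?_ ?_ ?_ ?_ ?_ <;>
  rw [commutator_ι_glSingle] <;>
  simp only [← ι_glSingle_smul, ← ι_glSingle_add, hs] <;>
  congr 2 <;>
  generalize Y i 0 0 = p at * <;>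
  generalize Y i 0 1 = q at * <;>
  generalize Y i 1 0 = r at * <;>
  generalize Y i 1 1 = s at * <;>
  try rw [hY]
  all_goals
    ext a b
    fin_cases a <;> fin_cases b <;> simp <;> ring

open Classical in
/-- The element of the Cartan subalgebra with the given component at `i` and `0` elsewhere. -/
def cartanSingle (i : κ) (d : Fin 2 → ℂ) : Cartan κ := Pi.single i d

theorem diagHom_cartanSingle (i : κ) (d : Fin 2 → ℂ) :
    diagHom κ (cartanSingle i d) = glSingle i (Matrix.diagonal d) := by
  classical
  funext j
  by_cases hj : j = i
  · subst hj
    simp [glSingle, cartanSingle, diagHom]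
  · simp [glSingle, cartanSingle, diagHom, Pi.single_eq_of_ne hj]

variable [Fintype κ]

theorem rho_cartanSingle (i : κ) (d : Fin 2 → ℂ) :
    rho κ (cartanSingle i d) = (d 0 - d 1) / 2 := by
  classical
  change ∑ j, (cartanSingle i d j 0 - cartanSingle i d j 1) / 2 = _
  rw [Finset.sum_eq_single i]
  · simp [cartanSingle]
  · intro j _ hj
    simp [cartanSingle, Pi.single_eq_of_ne hj]
  · simp

theorem toDual_ofCoords_cartanSingle (c : κ → Fin 2 → ℂ) (i : κ) (d : Fin 2 → ℂ) :
    toDual (ofCoords c) (cartanSingle i d) = c i 0 * d 0 + c i 1 * d 1 := by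
  classical
  rw [toDual_ofCoords, Finset.sum_eq_single i]
  · simp [cartanSingle, Fin.sum_univ_two]
  · intro j _ hj
    simp [cartanSingle, Pi.single_eq_of_ne hj]
  · simp

variable {V : Type*} [AddCommGroup V] [Module ℂ V] {act : Enveloping κ →ₐ[ℂ] Module.End ℂ V}
  {c : κ → Fin 2 → ℂ} {v : V}

theorem HasHarishChandraParameter.act_one (h : HasHarishChandraParameter act (ofCoords c) v)
    (i : κ) : act (UniversalEnvelopingAlgebra.ι ℂ (glSingle i 1)) v = (c i 0 + c i 1) • v := by
  have hz := h _ (ι_glSingle_one_mem_center i)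
    (UniversalEnvelopingAlgebra.ι ℂ (cartanSingle i 1)) (by
      rw [cartanToEnveloping_ι, diagHom_cartanSingle]
      simp)
  rw [hz, evalCartan_ι, LinearMap.sub_apply, rho_cartanSingle, toDual_ofCoords_cartanSingle]
  simp

/-- With `x = c₀ - c₁`, the value of `h` at `λ - ρ` is `x - 1`, and `(x - 1) ^ 2 + 2(x - 1) = x ^ 2
- 1`: the shift by `ρ` makes the result symmetric under the Weyl group. -/
theorem HasHarishChandraParameter.act_casimir (h : HasHarishChandraParameter act (ofCoords c) v)
    (i : κ) : act (casimir i) v = ((c i 0 - c i 1) ^ 2 - 1) • v := by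
  classical
  have hd : diagHom κ (cartanSingle i ![1, -1]) = glSingle i !![1, 0; 0, -1] := by
    rw [diagHom_cartanSingle]
    congr 1
    ext a b
    fin_cases a <;> fin_cases b <;> simp
  have hz := h _ (casimir_mem_center i)
    (UniversalEnvelopingAlgebra.ι ℂ (cartanSingle i ![1, -1]) *
      UniversalEnvelopingAlgebra.ι ℂ (cartanSingle i ![1, -1]) +
      (2 : ℂ) • UniversalEnvelopingAlgebra.ι ℂ (cartanSingle i ![1, -1])) (by
      rw [map_add, map_mul, map_smul, cartanToEnveloping_ι, hd, casimir, add_sub_cancel_left,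
        ← smul_mul_assoc]
      refine (nilIdeal κ).mul_mem_left _ (Ideal.subset_span ⟨_, fun j => ?_, rfl⟩)
      by_cases hj : j = i
      · subst hj
        simp [glSingle]
      · simp [glSingle, Pi.single_eq_of_ne hj])
  rw [hz]
  congr 1
  rw [map_add, map_mul, map_smul, evalCartan_ι, LinearMap.sub_apply, rho_cartanSingle,
    toDual_ofCoords_cartanSingle]
  simp
  ring

end Casimir

/-! ### The lattice `X_•(T̂*)` and integrality -/

section Lattice

variable {κ : Type*}

theorem torusElement_mem_GStar_iff (x : κ → Fin 2 → ℂˣ) :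
    torusElement x ∈ GStar κ ↔ ∃ c : ℂˣ, ∀ i, x i 0 * x i 1 = c := by
  refine exists_congr fun c => forall_congr' fun i => ?_
  rw [← Units.val_inj, ← Units.val_inj (a := x i 0 * x i 1)]
  have : ((torusElement x i).det : ℂ) = ((x i 0 * x i 1 : ℂˣ) : ℂ) := by
    change (Matrix.diagonal fun j => ((x i j : ℂˣ) : ℂ)).det = _
    simp
  rw [this]

variable [Fintype κ]

theorem sum_eq_zero_of_mem_starAnnihilator {χ : CharLattice κ} (hχ : χ ∈ starAnnihilator κ) :
    ∑ i, χ i 1 = 0 := by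
  -- Evaluation at `diag(1, 2)` in every component, a point of `T*`; as 2 is not a root of unity,
  -- the exponent must vanish.
  have h := hχ (fun _ => ![1, Units.mk0 2 two_ne_zero])
    ((torusElement_mem_GStar_iff _).2 ⟨Units.mk0 2 two_ne_zero, fun i => by simp⟩)
  have h' : (2 : ℝ) ^ (∑ i, χ i 1) = 1 := by
    have e := congrArg (fun u : ℂˣ => (u : ℂ)) h
    simp only [charEval, Fin.prod_univ_two, Matrix.cons_val_zero, Matrix.cons_val_one, one_zpow,
      one_mul, Units.coe_prod, Units.val_zpow_eq_zpow_val, Units.val_mk0, Units.val_one] at e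
    have hs : ∀ s : Finset κ, (2 : ℝ) ^ (∑ i ∈ s, χ i 1) = ∏ i ∈ s, (2 : ℝ) ^ χ i 1 := by
      classical
      intro s
      induction s using Finset.induction_on with
      | empty => simp
      | insert a s ha ih =>
        rw [Finset.sum_insert ha, Finset.prod_insert ha, zpow_add₀ two_ne_zero, ih]
    rw [hs]
    apply Complex.ofReal_injective
    push_cast
    exact e
  exact (zpow_eq_one_iff_right₀ (by norm_num) (by norm_num)).1 h'

/-- The functional on `X^•(T*)` given by the cocharacter `c ↦ diag(1, c)` of `T*`. -/
def sumCochar (κ : Type*) [Fintype κ] : CocharStar κ →ₗ[ℤ] ℤ :=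
  (starAnnihilator κ).liftQ
    { toFun := fun χ => ∑ i, χ i 1
      map_add' := fun χ χ' => by simp [Finset.sum_add_distrib]
      map_smul' := fun c χ => by simp [Finset.mul_sum] }
    fun _ hχ => sum_eq_zero_of_mem_starAnnihilator hχ

-- The constant function 1 supported at `i` is the determinant of the component `i`, and all these
-- determinants agree on `T*`.
open Classical in
theorem single_sub_single_mem_starAnnihilator (i j : κ) :
    (Pi.single i 1 - Pi.single j 1 : CharLattice κ) ∈ starAnnihilator κ := by
  intro x hx
  obtain ⟨c, hc⟩ := (torusElement_mem_GStar_iff x).1 hx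
  have e : ∀ i : κ, charEval (Pi.single i 1 : CharLattice κ) x = c := by
    intro i
    rw [charEval, Finset.prod_eq_single i]
    · simp [Fin.prod_univ_two, hc]
    · intro j _ hj
      simp [Pi.single_eq_of_ne hj]
    · simp
  have e2 : charEval (Pi.single i 1 - Pi.single j 1 : CharLattice κ) x =
      charEval (Pi.single i 1 : CharLattice κ) x / charEval (Pi.single j 1 : CharLattice κ) x := by
    simp only [charEval, Pi.sub_apply, zpow_sub, div_eq_mul_inv,
      Finset.prod_mul_distrib, Finset.prod_inv_distrib]
  rw [e2, e, e, div_self']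

/-- An element of `X_•(T̂)_ℂ` whose pairing with the coroots is integral has integral image in
`X_•(T̂*)_ℂ` if and only if the sum of its second coordinates is an integer. -/
theorem isIntegralStar_starImage_ofCoords (c : κ → Fin 2 → ℂ) (m : κ → ℤ)
    (hm : ∀ i, c i 0 - c i 1 = m i) :
    IsIntegralStar (starImage (ofCoords c)) ↔ ∃ n : ℤ, ∑ i, c i 1 = n := by
  classical
  constructor
  · rintro ⟨μ, hμ⟩
    refine ⟨sumCochar κ μ, ?_⟩
    -- Pairing both sides with the cocharacter `c ↦ diag(1, c)` of `T*`, extended to complex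
    -- coefficients, reads off the sum of the second coordinates.
    have e := congrArg (TensorProduct.lid ℤ ℂ ∘ TensorProduct.comm ℤ ℂ ℤ ∘
      (sumCochar κ).lTensor ℂ) hμ
    simp only [starImage, ofCoords, map_sum, Function.comp_apply, LinearMap.baseChange_tmul,
      LinearMap.lTensor_tmul, TensorProduct.comm_tmul, TensorProduct.lid_tmul] at e
    rw [zsmul_eq_mul, mul_one] at e
    rw [← e]
    refine Finset.sum_congr rfl fun i _ => ?_
    have hs : ∀ j, sumCochar κ ((starAnnihilator κ).mkQ
        (Pi.single i (Pi.single j 1) : CharLattice κ)) = (Pi.single j 1 : Fin 2 → ℤ) 1 := by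
      intro j
      change ∑ a, (Pi.single i (Pi.single j 1) : CharLattice κ) a 1 = _
      rw [Finset.sum_eq_single i]
      · simp
      · intro a _ ha
        simp [Pi.single_eq_of_ne ha]
      · simp
    rw [Fin.sum_univ_two, hs, hs]
    simp
  · rintro ⟨n, hn⟩
    rcases isEmpty_or_nonempty κ with hκ | ⟨⟨o⟩⟩
    · exact ⟨0, by simp [starImage, ofCoords]⟩
    -- Let `ε_i` be the first coordinate character and `δ_i` the determinant at `i`. Then `λ = ∑
    -- (c_i0 - c_i1) ε_i + ∑ c_i1 δ_i`, and all `δ_i` have the same image, represented by the one at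
    -- `o`.
    refine ⟨∑ i, m i • (starAnnihilator κ).mkQ (Pi.single i (Pi.single 0 1)) +
      n • (starAnnihilator κ).mkQ (Pi.single o 1), ?_⟩
    have hδ : ∀ i, (starAnnihilator κ).mkQ (Pi.single i (Pi.single 0 1)) +
        (starAnnihilator κ).mkQ (Pi.single i (Pi.single 1 1)) =
        (starAnnihilator κ).mkQ (Pi.single o 1) := by
      intro i
      rw [← map_add, ← Pi.single_add]
      have h1 : (Pi.single 0 1 + Pi.single 1 1 : Fin 2 → ℤ) = 1 := by
        funext j
        fin_cases j <;> simp
      rw [h1, ← sub_eq_zero, ← map_sub, Submodule.mkQ_apply, Submodule.Quotient.mk_eq_zero]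
      exact single_sub_single_mem_starAnnihilator i o
    have hsm : ∀ (a : ℤ) (x : CocharStar κ), (1 : ℂ) ⊗ₜ[ℤ] (a • x) = (a : ℂ) ⊗ₜ[ℤ] x := by
      intro a x
      rw [← TensorProduct.smul_tmul, zsmul_eq_mul, mul_one]
    rw [TensorProduct.tmul_add, TensorProduct.tmul_sum, hsm, ← hn, TensorProduct.sum_tmul,
      ← Finset.sum_add_distrib, starImage, ofCoords, map_sum]
    refine Finset.sum_congr rfl fun i _ => ?_
    rw [Fin.sum_univ_two, map_add, LinearMap.baseChange_tmul, LinearMap.baseChange_tmul, hsm,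
      ← hm, ← hδ i, TensorProduct.tmul_add, ← add_assoc, ← TensorProduct.add_tmul,
      sub_add_cancel]

end Lattice

/-! ### Counting the places above a place of `E` -/

section Places

variable {F : Type*} [Field F] [NumberField F] [IsTotallyReal F]
  {E : Type*} [Field E] [NumberField E] [Algebra E F]

theorem mk_injective_of_isTotallyReal {K : Type*} [Field K] [NumberField K] [IsTotallyReal K]
    {φ ψ : K →+* ℂ} (h : InfinitePlace.mk φ = InfinitePlace.mk ψ) : φ = ψ := by
  rcases InfinitePlace.mk_eq_iff.1 h with h | h
  · exact h
  · rwa [ComplexEmbedding.isReal_iff.1 (IsTotallyReal.complexEmbedding_isReal φ)] at h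

/-- Both fields are totally real, so an infinite place is the same as a complex embedding. The
places above `τ` are then the extensions to `F` of the embedding of `τ`, and there are `[F:E]` of
them. -/
theorem card_placesOver (τ : InfinitePlace E) :
    Fintype.card (PlacesOver F τ) = Module.finrank E F := by
  have : IsTotallyReal E := IsTotallyReal.of_algebra E F
  let : Algebra E ℂ := τ.embedding.toAlgebra
  rw [← AlgHom.card E F ℂ]
  symm
  refine Fintype.card_of_bijective (f := fun φ : F →ₐ[E] ℂ =>
    (⟨InfinitePlace.mk (φ : F →+* ℂ), ?_⟩ : PlacesOver F τ)) ⟨?_, ?_⟩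
  · rw [InfinitePlace.comap_mk, AlgHom.comp_algebraMap]
    exact InfinitePlace.mk_embedding τ
  · intro φ ψ h
    have := mk_injective_of_isTotallyReal (congrArg Subtype.val h)
    exact AlgHom.coe_ringHom_injective this
  · rintro ⟨σ, hσ⟩
    have hc : σ.embedding.comp (algebraMap E F) = τ.embedding := by
      refine mk_injective_of_isTotallyReal ?_
      rw [InfinitePlace.mk_embedding, ← InfinitePlace.comap_mk, InfinitePlace.mk_embedding, hσ]
    refine ⟨{ σ.embedding with commutes' := fun x => congrArg (fun f => f x) hc }, ?_⟩
    exact Subtype.ext (InfinitePlace.mk_embedding σ)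

end Places

/-! ### Uniqueness of the parameter, integrality and parity -/

section Parameters

open UpperHalfPlane

variable {F : Type*} [Field F] [NumberField F] {E : Type*} [Field E] [Algebra E F]

theorem isHolomorphic_const {ι : Type*} [Fintype ι] (c : ℂ) :
    IsHolomorphic (fun _ : ι → ℍ => c) :=
  analyticOnNhd_const

/-- The function on the group attached to a nonzero function on `ℍ^ι` is nonzero. -/
theorem smoothLift_ne_zero {ι : Type*} [Fintype ι] (k : ι → ℤ) (t : ι → ℝ) {h : (ι → ℍ) → ℂ}
    (hh : IsHolomorphic h) (hne : h ≠ 0) : smoothLift k t h hh ≠ 0 := by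
  obtain ⟨z, hz⟩ := Function.ne_iff.1 hne
  intro h0
  -- The matrix `!![y, x; 0, 1]` carries `i` to `x + iy`, so every value of `h` occurs in the lift
  -- up to a nonzero factor.
  set g : RealMat ι := fun i => ![![(z i).im, (z i).re], ![0, 1]] with hg
  have hmem : g ∈ glPos ι := fun i => by
    simpa [hg, Matrix.det_fin_two] using (z i).im_pos
  have e : groupLift k t h g = 0 := congrFun (congrArg Subtype.val h0) g
  rw [groupLift_eq_complexLift k t h hmem] at e
  have hz' : (fun i => ofComplex (((g i 0 0 : ℂ) * Complex.I + g i 0 1) /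
      ((g i 1 0 : ℂ) * Complex.I + g i 1 1))) = z := by
    funext i
    have : ((g i 0 0 : ℂ) * Complex.I + g i 0 1) / ((g i 1 0 : ℂ) * Complex.I + g i 1 1) =
        (z i : ℂ) := by
      simp only [hg]
      simp
      rw [add_comm]
      exact Complex.re_add_im (z i : ℂ)
    rw [this, ofComplex_apply]
  simp only [complexLift, ofRealMat_apply, hz', ofReal_det_eq] at e
  have h1 : ∏ i, ((Matrix.of (g i)).det : ℂ) ^ ((k i : ℂ) + t i - 1) ≠ 0 := by
    refine Finset.prod_ne_zero_iff.2 fun i _ => ?_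
    rw [Complex.cpow_ne_zero_iff]
    exact Or.inl (by exact_mod_cast (hmem i).ne')
  have h2 : ∏ i, ((g i 1 0 : ℂ) * Complex.I + g i 1 1) ^ (-k i) ≠ 0 :=
    Finset.prod_ne_zero_iff.2 fun i _ => zpow_ne_zero _ (denom_ne_zero_of_mem_glPos hmem i)
  exact mul_ne_zero (mul_ne_zero h1 h2) hz e

/-- A Harish-Chandra parameter of one nonzero function attached to a holomorphic function is a
Harish-Chandra parameter of the weight. -/
theorem isWeightHarishChandraParameter_of_ne_zero {k : Weight F} {t : InfinitePlace F → ℝ}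
    {τ : InfinitePlace E} {lam : ℂ ⊗[ℤ] CharLattice (PlacesOver F τ)}
    {h : (InfinitePlace F → ℍ) → ℂ} (hh : IsHolomorphic h) (hne : h ≠ 0)
    (hlam : HasHarishChandraParameter (placeAction F τ) lam (smoothLift k t h hh)) :
    IsWeightHarishChandraParameter k t τ lam := by
  intro h' hh' z hz p hp
  have hw := isWeightHarishChandraParameter_weightParameter k t τ
  -- Two scalars by which `z` acts on the same nonzero vector are equal, and the one coming from the
  -- weight is valid for every `h'`.
  have e := (hw h hh z hz p hp).symm.trans (hlam z hz p hp)
  rw [hw h' hh' z hz p hp, smul_left_injective ℂ (smoothLift_ne_zero k t hh hne) e]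

/-- The parameter of the weight `(k, t)` is determined up to the action of the Weyl group. -/
theorem IsWeightHarishChandraParameter.coords {k : Weight F} {t : InfinitePlace F → ℝ}
    {τ : InfinitePlace E} {c : PlacesOver F τ → Fin 2 → ℂ}
    (hc : IsWeightHarishChandraParameter k t τ (ofCoords c)) (σ : PlacesOver F τ) :
    (c σ 0 = (t σ : ℂ) - 1 / 2 ∧ c σ 1 = (k σ : ℂ) + t σ - 3 / 2) ∨
      (c σ 0 = (k σ : ℂ) + t σ - 3 / 2 ∧ c σ 1 = (t σ : ℂ) - 1 / 2) := by
  have hh := isHolomorphic_const (ι := InfinitePlace F) 1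
  have hne := smoothLift_ne_zero k t hh fun h => one_ne_zero (congrFun h fun _ => I)
  have hw := isWeightHarishChandraParameter_weightParameter k t τ _ hh
  have e1 := smul_left_injective ℂ hne (((hc _ hh).act_one σ).symm.trans (hw.act_one σ))
  have e2 := smul_left_injective ℂ hne (((hc _ hh).act_casimir σ).symm.trans (hw.act_casimir σ))
  simp only [Matrix.cons_val_zero, Matrix.cons_val_one] at e1 e2
  -- The trace element fixes `c₀ + c₁` and the Casimir element fixes `(c₀ - c₁) ^ 2`, so `c₀` is a
  -- root of the quadratic with the two expected roots.
  have e3 : (c σ 0 - ((t σ : ℂ) - 1 / 2)) * (c σ 0 - ((k σ : ℂ) + t σ - 3 / 2)) = 0 := by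
    have e4 : c σ 1 = (k σ : ℂ) + 2 * t σ - 2 - c σ 0 := by linear_combination e1
    rw [e4] at e2
    linear_combination e2 / 4
  rcases mul_eq_zero.1 e3 with h | h
  · exact Or.inl ⟨by linear_combination h, by linear_combination e1 - h⟩
  · exact Or.inr ⟨by linear_combination h, by linear_combination e1 - h⟩

/-- Whichever representative of the Weyl orbit is chosen at each place, both coordinates are
congruent to `t - 1/2` modulo the integers, since they differ by `±(k - 1)`. -/
theorem IsWeightHarishChandraParameter.isIntegralStar_iff {k : Weight F}
    {t : InfinitePlace F → ℝ} {τ : InfinitePlace E} {lam : ℂ ⊗[ℤ] CharLattice (PlacesOver F τ)}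
    (hlam : IsWeightHarishChandraParameter k t τ lam) :
    IsIntegralStar (starImage lam) ↔ ∃ n : ℤ, ∑ σ : PlacesOver F τ, (t σ - 1 / 2) = n := by
  obtain ⟨c, rfl⟩ := exists_eq_ofCoords lam
  have hm : ∀ σ : PlacesOver F τ, ∃ m r : ℤ,
      c σ 0 - c σ 1 = m ∧ c σ 1 = (t σ : ℂ) - 1 / 2 + r := by
    intro σ
    rcases hlam.coords σ with ⟨h0, h1⟩ | ⟨h0, h1⟩
    · exact ⟨1 - k σ, k σ - 1, by rw [h0, h1]; push_cast; ring, by rw [h1]; push_cast; ring⟩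
    · exact ⟨k σ - 1, 0, by rw [h0, h1]; push_cast; ring, by rw [h1]; push_cast; ring⟩
  choose m r hm hr using hm
  rw [isIntegralStar_starImage_ofCoords c m hm]
  have hsum : ∑ σ, c σ 1 = ((∑ σ : PlacesOver F τ, (t σ - 1 / 2) : ℝ) : ℂ) +
      ((∑ σ, r σ : ℤ) : ℂ) := by
    push_cast
    rw [← Finset.sum_add_distrib]
    exact Finset.sum_congr rfl fun σ _ => hr σ
  rw [hsum]
  constructor
  · rintro ⟨n, hn⟩
    refine ⟨n - ∑ σ, r σ, ?_⟩
    have : ((∑ σ : PlacesOver F τ, (t σ - 1 / 2) : ℝ) : ℂ) = ((n - ∑ σ, r σ : ℤ) : ℂ) := by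
      rw [Int.cast_sub]
      linear_combination hn
    exact_mod_cast this
  · rintro ⟨n, hn⟩
    exact ⟨n + ∑ σ, r σ, by rw [hn]; push_cast; ring⟩

theorem sum_placesOver_eq {k : Weight F} {t : InfinitePlace F → ℝ} {w : ℝ}
    (hw : ∀ σ, (k σ : ℝ) + 2 * t σ = w) (τ : InfinitePlace E) :
    ∑ σ : PlacesOver F τ, (t σ - 1 / 2) =
      ((w - 1) * Fintype.card (PlacesOver F τ) - k.restrict E τ) / 2 := by
  have : ∀ σ : PlacesOver F τ, t σ - 1 / 2 = ((w - 1) - k σ) / 2 := fun σ => by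
    linarith [hw σ]
  rw [Finset.sum_congr rfl fun σ _ => this σ, ← Finset.sum_div, Finset.sum_sub_distrib]
  simp [Weight.restrict]
  ring

variable [IsTotallyReal F] [NumberField E]

theorem exists_reasonable_integral_iff_eParitious (k : Weight F) :
    (∃ t : InfinitePlace F → ℝ, Reasonable k t ∧
      ∀ τ : InfinitePlace E, ∃ n : ℤ, ∑ σ : PlacesOver F τ, (t σ - 1 / 2) = n) ↔
      EParitious E k := by
  constructor
  · rintro ⟨t, ht, hint⟩ τ τ'
    obtain ⟨σ₀⟩ : Nonempty (InfinitePlace F) := inferInstance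
    have hw : ∀ σ, (k σ : ℝ) + 2 * t σ = k σ₀ + 2 * t σ₀ := fun σ => ht σ σ₀
    obtain ⟨n, hn⟩ := hint τ
    obtain ⟨n', hn'⟩ := hint τ'
    rw [sum_placesOver_eq hw, card_placesOver] at hn hn'
    refine Int.modEq_iff_dvd.2 ⟨n - n', ?_⟩
    -- The term `(w - 1)[F:E]` is common to both places and drops out of the difference.
    have : ((k.restrict E τ' : ℤ) : ℝ) - k.restrict E τ = 2 * (n - n') := by linarith
    exact_mod_cast this
  · intro hk
    obtain ⟨τ₀⟩ : Nonempty (InfinitePlace E) := inferInstance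
    have hd : (Module.finrank E F : ℝ) ≠ 0 := by
      have : Module.finrank E F ≠ 0 := Module.finrank_pos.ne'
      exact_mod_cast this
    -- Chosen so that `(w - 1)[F:E] = k_E(τ₀)`; the sum above `τ` becomes `(k_E(τ₀) - k_E(τ)) / 2`,
    -- an integer by parity. This `w` need not be an integer.
    set w : ℝ := 1 + (k.restrict E τ₀ : ℝ) / Module.finrank E F with hw
    have ht : ∀ σ, (k σ : ℝ) + 2 * ((w - k σ) / 2) = w := fun σ => by ring
    refine ⟨fun σ => (w - k σ) / 2, fun σ σ' => by rw [ht, ht], fun τ => ?_⟩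
    obtain ⟨n, hn⟩ := Int.modEq_iff_dvd.1 (hk τ τ₀)
    refine ⟨n, ?_⟩
    rw [sum_placesOver_eq ht, card_placesOver]
    have e : (w - 1) * (Module.finrank E F : ℝ) = k.restrict E τ₀ := by
      rw [hw]
      field_simp
      ring
    have hn' : ((k.restrict E τ₀ : ℤ) : ℝ) - k.restrict E τ = 2 * n := by exact_mod_cast hn
    rw [e, hn']
    ring

end Parameters

end

end Hilbert

theorem mainTheorem8 {F : Type*} [Field F] [NumberField F] [IsTotallyReal F]
    {E : Type*} [Field E] [NumberField E] [Algebra E F] (k : Weight F) :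
    (∀ (t : InfinitePlace F → ℝ)
      (Pi : Submodule ℂ (GL (Fin 2) (FinAdele F) → (InfinitePlace F → UpperHalfPlane) → ℂ)),
      IsSubrepresentation k t Pi → Pi ≠ ⊥ →
      ∀ τ : InfinitePlace E,
        (∃ lam, IsHarishChandraParameter k t Pi τ lam) ∧
        ∀ lam : ℂ ⊗[ℤ] CharLattice (PlacesOver F τ),
          (IsHarishChandraParameter k t Pi τ lam ↔
            IsWeightHarishChandraParameter k t τ lam) ∧
          (IsHarishChandraParameter k t Pi τ lam →
            (IsIntegralStar (starImage lam) ↔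
              ∃ n : ℤ, ∑ σ : PlacesOver F τ, (t σ - 1 / 2) = n))) ∧
    ((∃ t : InfinitePlace F → ℝ, Reasonable k t ∧
      ∀ τ : InfinitePlace E, ∃ lam : ℂ ⊗[ℤ] CharLattice (PlacesOver F τ),
        IsWeightHarishChandraParameter k t τ lam ∧ IsIntegralStar (starImage lam)) ↔
      EParitious E k) := by
  refine ⟨fun t Pi hPi hne τ => ⟨⟨weightParameter k t τ, fun f _ hf g =>
    isWeightHarishChandraParameter_weightParameter k t τ _ (hf.holo g)⟩, fun lam => ?_⟩, ?_⟩
  · have hiff : IsHarishChandraParameter k t Pi τ lam ↔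
        IsWeightHarishChandraParameter k t τ lam := by
      refine ⟨fun hlam => ?_, fun hlam f _ hf g => hlam _ (hf.holo g)⟩
      -- One nonzero `f` in `Pi` and one `g` with `f g ≠ 0` suffice, since the central character is
      -- the same for all holomorphic functions.
      obtain ⟨f, hfPi, hf0⟩ := (Submodule.ne_bot_iff _).1 hne
      obtain ⟨g, hg⟩ := Function.ne_iff.1 hf0
      have hf := hPi.forms f hfPi
      exact isWeightHarishChandraParameter_of_ne_zero (hf.holo g) hg (hlam f hfPi hf g)
    exact ⟨hiff, fun hlam => (hiff.1 hlam).isIntegralStar_iff⟩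
  · rw [← exists_reasonable_integral_iff_eParitious]
    refine exists_congr fun t => and_congr_right fun _ => forall_congr' fun τ => ?_
    constructor
    · rintro ⟨lam, hlam, hint⟩
      exact hlam.isIntegralStar_iff.1 hint
    · intro hint
      have hw := isWeightHarishChandraParameter_weightParameter k t τ
      exact ⟨_, hw, hw.isIntegralStar_iff.2 hint⟩
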